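/- **Setting.** Let $\mathcal M$ be a finite MDP with state set $\mathcal S$ ($|\mathcal S|=S$), action set $\mathcal A$ ($|\mathcal A|=A$), transition probabilities $\mathcal P(s,a,q)$, random rewards $r(s,a)$ whose means exist and satisfy $0\le \mathbb E[r(s,a)]\le 1$, and initial state $s_0$. Let $\gamma\in(0,1)$, and assume that there is an absorbing final state $s_\circ\in\mathcal S$ with reward $0$ such that $\mathcal P(s,a,s_\circ)=1-\gamma$ for all $s\ne s_\circ$ and all $a$. For a stationary policy $\pi$, let $V^\pi_{\mathcal M}(s_0)$ be the expected total reward of the infinite path started at $s_0$, let $x^\pi(s,a)$ be the expected number of times $a$ is taken at $s$, and let $\rho^\pi(s,a)$ be the probability that $a$ is taken at $s$ at least once. Given $N$ sample paths, let $n(s,a,q)$ be the total number of observed transitions from $s$ to $q$ under $a$. The estimated model $\hat{\mathcal M}$ has the same rewards and initial state as $\mathcal M$ and the following transition probabilities. For $s\neq s_\circ$ with $\sum_q n(s,a,q)>0$, $\hat{\mathcal P}(s,a,\cdot)$ is the probability vector that minimizes the Euclidean distance to the empirical frequencies $n(s,a,\cdot)/\sum_q n(s,a,q)$ subject to $\hat{\mathcal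 P}(s,a,s_\circ)=1-\gamma$. If $s\neq s_\circ$ and $\sum_q n(s,a,q)=0$, then $\hat{\mathcal P}(s,a,s)=\gamma$ and $\hat{\mathcal P}(s,a,s_\circ)=1-\gamma$. The state $s_\circ$ stays absorbing. **Theorem.** There are universal constants $C>0$ and $k\in\mathbb N$ such that the following holds for every such $\mathcal M$, all stationary policies $\pi^b$ (behavior) and $\pi^t$ (target), and all $\varepsilon>0$ and $\delta\in(0,1)$. For $\beta\in[0,1]$ let $$D_\beta=\Big\{(s,a): s\ne s_\circ,\ x^{\pi^t}(s,a)\ \ge\ \frac{(\varepsilon/2)^{1/\beta}(1-\gamma)^{(2-\beta)/\beta}}{SA}\Big\},$$ where the threshold is read as $0$ for $\beta=0$. Let $N$ sample paths be collected independently under $\pi^b$; transitions within one path may be dependent. If $$N\ \ge\ C\,\log^k\!\Big(S+A+\tfrac1{1-\gamma}+\tfrac1\varepsilon\Big)\log\!\Big(\tfrac2\delta\Big)\ \inf_{\beta\in[0,1]}\ \max_{(s,a)\in D_\beta}\ \max\left(\frac{S^{1+2\beta}A^{2\beta}}{(1-\gamma)^{4-2\beta}}\cdot\frac{x^{\pi^t}(s,a)^{2\beta}}{x^{\pi^b}(s,a)}\cdot\frac1{\varepsilon^2},\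 \frac{1}{\gamma\,\rho^{\pi^b}(s,a)}\right),$$ where division by $0$ gives $+\infty$ and a maximum over the empty set is $0$, then with probability at least $1-\delta$ $$\big|V^{\pi^t}_{\mathcal M}(s_0)-V^{\pi^t}_{\hat{\mathcal M}}(s_0)\big|\le\varepsilon .$$ -/

import Mathlib

open MeasureTheory ProbabilityTheory
open scoped ENNReal

noncomputable section

/-- A finite Markov decision process: transition probabilities `trans s a q`, a random reward with
law `reward s a` whose mean exists and lies in `[0, 1]`, and an initial state. -/
structure MDP (S A : Type*) [Fintype S] where
  trans : S → A → S → ℝ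
  trans_nonneg : ∀ s a q, 0 ≤ trans s a q
  trans_sum : ∀ s a, ∑ q, trans s a q = 1
  reward : S → A → Measure ℝ
  reward_prob : ∀ s a, IsProbabilityMeasure (reward s a)
  reward_integrable : ∀ s a, Integrable (fun r : ℝ => r) (reward s a)
  reward_mean_nonneg : ∀ s a, 0 ≤ ∫ r, r ∂(reward s a)
  reward_mean_le_one : ∀ s a, ∫ r, r ∂(reward s a) ≤ 1
  init : S

/-- An MDP with an absorbing, reward-free final state, reached from every other state with
probability `1 - γ` under every action. -/
structure DiscountedMDP (S A : Type*) [Fintype S] extends MDP S A where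
  γ : ℝ
  γ_pos : 0 < γ
  γ_lt_one : γ < 1
  final : S
  final_absorbing : ∀ a, trans final a final = 1
  final_reward : ∀ a, reward final a = Measure.dirac 0
  trans_final : ∀ s a, s ≠ final → trans s a final = 1 - γ

/-- A stationary (randomized) policy. -/
structure Policy (S A : Type*) [Fintype A] where
  prob : S → A → ℝ
  prob_nonneg : ∀ s a, 0 ≤ prob s a
  prob_sum : ∀ s, ∑ a, prob s a = 1

/-- One time step of a path: state, action, reward. -/
abbrev Step (S A : Type*) := S × A × ℝ

/-- An infinite path `s₀ a₀ r₀ s₁ a₁ r₁ …`. -/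
abbrev SamplePath (S A : Type*) := ℕ → Step S A

section Finite

variable {S A : Type*} [Fintype S] [Fintype A] [MeasurableSpace S] [MeasurableSpace A]

namespace MDP

/-- The law of `(s, a, r)` at a time at which the state is `s`: the action is drawn from the policy
and the reward from the reward law of `(s, a)`. -/
def stepLaw (M : MDP S A) (π : Policy S A) (s : S) : Measure (Step S A) :=
  ∑ a, ENNReal.ofReal (π.prob s a) • (M.reward s a).map (fun r => (s, a, r))

/-- The law of the next step after action `a` in state `s`. -/
def nextLaw (M : MDP S A) (π : Policy S A) (s : S) (a : A) : Measure (Step S A) :=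
  ∑ q, ENNReal.ofReal (M.trans s a q) • M.stepLaw π q

instance isProbabilityMeasure_stepLaw (M : MDP S A) (π : Policy S A) (s : S) :
    IsProbabilityMeasure (M.stepLaw π s) := by
  constructor
  have h : ∀ a, ((M.reward s a).map (fun r => (s, a, r))) Set.univ = 1 := fun a => by
    have := M.reward_prob s a
    rw [Measure.map_apply (by fun_prop) MeasurableSet.univ]
    simp
  simp only [stepLaw, Measure.coe_finsetSum, Finset.sum_apply, Measure.smul_apply, h,
    smul_eq_mul, mul_one]
  rw [← ENNReal.ofReal_sum_of_nonneg (fun a _ => π.prob_nonneg s a), π.prob_sum,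
    ENNReal.ofReal_one]

instance isProbabilityMeasure_nextLaw (M : MDP S A) (π : Policy S A) (s : S) (a : A) :
    IsProbabilityMeasure (M.nextLaw π s a) := by
  constructor
  simp only [nextLaw, Measure.coe_finsetSum, Finset.sum_apply, Measure.smul_apply, measure_univ,
    smul_eq_mul, mul_one]
  rw [← ENNReal.ofReal_sum_of_nonneg (fun q _ => M.trans_nonneg s a q), M.trans_sum,
    ENNReal.ofReal_one]

variable [MeasurableSingletonClass S] [MeasurableSingletonClass A]

/-- The Markov transition kernel on steps under a stationary policy. -/
def stepKernel (M : MDP S A) (π : Policy S A) : Kernel (Step S A) (Step S A) :=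
  Kernel.comap (Kernel.ofFunOfCountable (fun p : S × A => M.nextLaw π p.1 p.2))
    (fun z => (z.1, z.2.1)) (measurable_fst.prodMk (measurable_fst.comp measurable_snd))

instance isMarkovKernel_stepKernel (M : MDP S A) (π : Policy S A) :
    IsMarkovKernel (M.stepKernel π) :=
  ⟨fun z => M.isProbabilityMeasure_nextLaw π z.1 z.2.1⟩

/-- The law of the infinite path generated by the stationary policy `π` from the initial state:
the Markov chain of steps with initial law `stepLaw` at `init` and kernel `stepKernel`. -/
def pathLaw (M : MDP S A) (π : Policy S A) : Measure (SamplePath S A) :=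
  Kernel.trajMeasure (X := fun _ => Step S A) (M.stepLaw π M.init)
    (fun n => (M.stepKernel π).comap (fun h => h ⟨n, by simp⟩) (by fun_prop))

/-- The value from the initial state: the expected total reward of a path. -/
def value (M : MDP S A) (π : Policy S A) : ℝ :=
  ∫ ξ, ∑' t, (ξ t).2.2 ∂(M.pathLaw π)

open Classical in
/-- The occupancy measure: the expected number of times that `a` is taken at `s`. -/
def occupancy (M : MDP S A) (π : Policy S A) (s : S) (a : A) : ℝ≥0∞ :=
  ∫⁻ ξ, ∑' t, (if (ξ t).1 = s ∧ (ξ t).2.1 = a then 1 else 0) ∂(M.pathLaw π)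

/-- The probability that `a` is taken at `s` at least once. -/
def reachProb (M : MDP S A) (π : Policy S A) (s : S) (a : A) : ℝ≥0∞ :=
  M.pathLaw π {ξ | ∃ t, (ξ t).1 = s ∧ (ξ t).2.1 = a}

end MDP

end Finite

section Empirical

variable {S A : Type*} [Fintype S]

/-- The number of sample transitions from `s` to `q` under `a` in the `N` sample paths
(almost surely finite for a non-final `s`; an infinite number is read as `0`). -/
def transCount {N : ℕ} (ξ : Fin N → SamplePath S A) (s : S) (a : A) (q : S) : ℕ :=
  Set.ncard {p : Fin N × ℕ |
    (ξ p.1 p.2).1 = s ∧ (ξ p.1 p.2).2.1 = a ∧ (ξ p.1 (p.2 + 1)).1 = q}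

/-- The empirical frequency of the transition from `s` to `q` under `a`. -/
def empFreq {N : ℕ} (ξ : Fin N → SamplePath S A) (s : S) (a : A) (q : S) : ℝ :=
  (transCount ξ s a q : ℝ) / ∑ q', (transCount ξ s a q' : ℝ)

namespace DiscountedMDP

/-- The probability vectors on the states that give the final state mass `1 - γ`. -/
def feasibleRows (M : DiscountedMDP S A) : Set (S → ℝ) :=
  {p | p ∈ stdSimplex ℝ S ∧ p M.final = 1 - M.γ}

lemma exists_projection (M : DiscountedMDP S A) (f : S → ℝ) (s : S) (a : A) (hs : s ≠ M.final) :
    ∃ p ∈ M.feasibleRows, IsMinOn (fun p : S → ℝ => ∑ q, (p q - f q) ^ 2) M.feasibleRows p := by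
  have hc : IsCompact M.feasibleRows :=
    (isCompact_stdSimplex ℝ S).inter_right
      (isClosed_eq (continuous_apply M.final) continuous_const)
  refine hc.exists_isMinOn ⟨M.trans s a, ⟨M.trans_nonneg s a, M.trans_sum s a⟩,
    M.trans_final s a hs⟩ ?_
  fun_prop

open Classical in
/-- The estimated transition probabilities. From the final state: absorption. From an unsampled
pair `(s, a)`: stay with probability `γ`, end with probability `1 - γ`. From a sampled pair: the
probability vector with mass `1 - γ` at the final state that is nearest in Euclidean distance to
the empirical frequencies. -/
def estTrans (M : DiscountedMDP S A) {N : ℕ} (ξ : Fin N → SamplePath S A) (s : S) (a : A) : S → ℝ :=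
  if hs : s = M.final then Pi.single M.final 1
  else if ∑ q, transCount ξ s a q = 0 then M.γ • Pi.single s 1 + (1 - M.γ) • Pi.single M.final 1
  else (M.exists_projection (empFreq ξ s a) s a hs).choose

lemma estTrans_mem_stdSimplex (M : DiscountedMDP S A) {N : ℕ} (ξ : Fin N → SamplePath S A) (s : S)
    (a : A) : M.estTrans ξ s a ∈ stdSimplex ℝ S := by
  classical
  unfold estTrans
  split_ifs with hs hn
  · exact single_mem_stdSimplex ℝ M.final
  · exact convex_stdSimplex ℝ S (single_mem_stdSimplex ℝ s) (single_mem_stdSimplex ℝ M.final)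
      M.γ_pos.le (by linarith [M.γ_lt_one]) (by ring)
  · exact (M.exists_projection (empFreq ξ s a) s a hs).choose_spec.1.1

/-- The estimated model: the estimated transition probabilities with the known rewards and the
known initial state. -/
def estModel (M : DiscountedMDP S A) {N : ℕ} (ξ : Fin N → SamplePath S A) : MDP S A :=
  { M.toMDP with
    trans := M.estTrans ξ
    trans_nonneg := fun s a => (M.estTrans_mem_stdSimplex ξ s a).1
    trans_sum := fun s a => (M.estTrans_mem_stdSimplex ξ s a).2 }

variable [Fintype A] [MeasurableSpace S] [MeasurableSpace A]
  [MeasurableSingletonClass S] [MeasurableSingletonClass A]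

/-- The threshold below which an occupancy of the target policy is negligible. For `β = 0` no
pair is negligible, which is the limit of the formula as `β → 0` (when `ε (1-γ)² < 2`). -/
def threshold (M : DiscountedMDP S A) (ε β : ℝ) : ℝ :=
  if β = 0 then 0
  else (ε / 2) ^ (1 / β) * (1 - M.γ) ^ ((2 - β) / β) / (Fintype.card S * Fintype.card A)

/-- The pairs of a non-final state and an action whose target occupancy is not negligible. -/
def relevantPairs (M : DiscountedMDP S A) (πt : Policy S A) (ε β : ℝ) : Set (S × A) :=
  {p | p.1 ≠ M.final ∧ ENNReal.ofReal (M.threshold ε β) ≤ M.occupancy πt p.1 p.2}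

/-- The quantity `S^(1+2β) A^(2β) x^πt(s,a)^(2β) / ((1-γ)^(4-2β) x^πb(s,a) ε²)`. -/
def coverageTerm (M : DiscountedMDP S A) (πb πt : Policy S A) (ε β : ℝ) (s : S) (a : A) : ℝ≥0∞ :=
  ENNReal.ofReal ((Fintype.card S : ℝ) ^ (1 + 2 * β) * (Fintype.card A : ℝ) ^ (2 * β) /
      ((1 - M.γ) ^ (4 - 2 * β) * ε ^ 2)) *
    (M.occupancy πt s a ^ (2 * β) / M.occupancy πb s a)

/-- The quantity `1 / (γ ρ^πb(s,a))`. -/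
def reachTerm (M : DiscountedMDP S A) (πb : Policy S A) (s : S) (a : A) : ℝ≥0∞ :=
  1 / (ENNReal.ofReal M.γ * M.reachProb πb s a)

/-- The sample size of order
`min_{β ∈ [0,1]} max_{(s,a) ∈ D} max (coverageTerm, reachTerm)`, with value `∞` for pairs that the
behavior policy never uses. -/
def requiredPaths (M : DiscountedMDP S A) (πb πt : Policy S A) (ε : ℝ) : ℝ≥0∞ :=
  ⨅ β ∈ Set.Icc (0 : ℝ) 1, ⨆ p ∈ M.relevantPairs πt ε β,
    max (M.coverageTerm πb πt ε β p.1 p.2) (M.reachTerm πb p.1 p.2)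

/-- The factor hidden in the `Õ` notation: a constant, a power of the logarithm of
`S, A, 1/(1-γ), 1/ε`, and one factor logarithmic in `1/δ`. -/
def logFactor (M : DiscountedMDP S A) (C : ℝ) (k : ℕ) (ε δ : ℝ) : ℝ :=
  C * Real.log (Fintype.card S + Fintype.card A + 1 / (1 - M.γ) + 1 / ε) ^ k * Real.log (2 / δ)

end DiscountedMDP

end Empirical

end

/-!
The value error is compared with the errors of the rows of the estimated model. By the simulation
lemma (`DiscountedMDP.abs_value_sub_le`), the two values differ by at most
`∑ x^πt(s,a) Δ(s,a)` over the pairs with `s` non-final, where `Δ(s,a)` bounds the error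
`|∑ q, (P - P̂)(s,a,q) W(q)|` against the finite-horizon values `W ∈ [0, 1/(1-γ)]` of the estimated
model. It is proved on finite horizons, where the values satisfy a recursion, and passes to the limit
because the rewards are absolutely summable in mean.

A row is accurate in `ℓ¹` up to `√(8 S L / n₀)` with `n₀ = N x^πb(s,a) / 2`, except with probability
of order `S exp (-L)` (`DiscountedMDP.measure_row_error_le`). There are two sources of error.

* The number of samples of `(s, a)` may be smaller than `n₀`. If `T` is the number of visits of one
  path, `G` the mean number of visits from a visit on, `x = E[T]` and `ρ` the probability of a visit,
  then the Markov property gives `E[T²] ≤ 2 x G` and `ρ G ≤ x`, so that `E[T²] ≤ 2 x² / ρ`, and the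
  Chernoff bound over the independent paths has exponent of order `N ρ`. This is where the term
  `1 / (γ ρ)` of the sample size is used.
* The frequencies may deviate from the transition probabilities. The number of moves from `(s, a)`
  to `q`, with its compensator and a variance term of the Bernstein type subtracted, is the exponent
  of a supermartingale (`DiscountedMDP.lintegral_exp_moveCount_le`), whatever the dependence within
  a path. The parameter is tuned to `n₀`, and the resulting bound improves with the actual sample
  size, so the random sample size costs nothing (`sq_div_sub_le`). The bounds of all `q` are squared
  and summed, and the Euclidean projection onto the feasible rows only decreases the Euclidean error.

With these row errors, weighted AM-GM bounds the contribution of the relevant pairs by `ε / 2`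
(`mul_sqrt_le_of_coverage`), and the threshold is such that the negligible pairs cost at most `ε / 2`
(`threshold_mul_inv_le`) unless `ε ≥ 1/(1-γ)`, when the claim is trivial. The infimum over `β` need
not be attained, but some `β` attains it up to a factor `2`, as each term of a maximum over a
nonempty set is at least `1`.
-/

/-! ### Finite-horizon values and the simulation lemma -/

namespace MDP

variable {S A : Type*} [Fintype S] [Fintype A]

/-- The mean reward `r̄(s, a)`. -/
noncomputable def meanReward (M : MDP S A) (s : S) (a : A) : ℝ := ∫ r, r ∂(M.reward s a)

open Classical in
/-- The probability that the state at time `t` is `s`, by the forward recursion. -/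
noncomputable def stateProb (M : MDP S A) (π : Policy S A) : ℕ → S → ℝ
  | 0 => Pi.single M.init 1
  | t + 1 => fun q => ∑ s, ∑ a, stateProb M π t s * π.prob s a * M.trans s a q

/-- The expected total reward of the first `n` steps from a state, by the backward recursion. -/
noncomputable def horizonValue (M : MDP S A) (π : Policy S A) : ℕ → S → ℝ
  | 0 => fun _ => 0
  | n + 1 => fun s =>
      ∑ a, π.prob s a * (M.meanReward s a + ∑ q, M.trans s a q * horizonValue M π n q)

lemma stateProb_nonneg (M : MDP S A) (π : Policy S A) (t : ℕ) (s : S) : 0 ≤ M.stateProb π t s := by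
  classical
  induction t generalizing s with
  | zero =>
    simp only [stateProb, Pi.single_apply]
    split_ifs <;> simp
  | succ t ih =>
    exact Finset.sum_nonneg fun s' _ => Finset.sum_nonneg fun a _ =>
      mul_nonneg (mul_nonneg (ih s') (π.prob_nonneg s' a)) (M.trans_nonneg _ _ _)

lemma sum_stateProb_succ_mul (M : MDP S A) (π : Policy S A) (t : ℕ) (f : S → ℝ) :
    ∑ q, M.stateProb π (t + 1) q * f q =
      ∑ s, M.stateProb π t s * ∑ a, π.prob s a * ∑ q, M.trans s a q * f q := by
  simp only [stateProb, Finset.sum_mul, Finset.mul_sum]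
  rw [Finset.sum_comm]
  refine Finset.sum_congr rfl fun s _ => ?_
  rw [Finset.sum_comm]
  exact Finset.sum_congr rfl fun a _ => Finset.sum_congr rfl fun q _ => by ring

lemma sum_stateProb_init_mul (M : MDP S A) (π : Policy S A) (f : S → ℝ) :
    ∑ s, M.stateProb π 0 s * f s = f M.init := by
  classical
  simp [stateProb, Pi.single_apply]

lemma sum_stateProb_mul_horizonValue (M : MDP S A) (π : Policy S A) (n t : ℕ) :
    ∑ s, M.stateProb π t s * M.horizonValue π n s =
      ∑ i ∈ Finset.range n, ∑ s, ∑ a, M.stateProb π (t + i) s * π.prob s a * M.meanReward s a := by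
  induction n generalizing t with
  | zero => simp [horizonValue]
  | succ n ih =>
    rw [Finset.sum_range_succ']
    have h1 := ih (t + 1)
    rw [sum_stateProb_succ_mul] at h1
    simp only [add_assoc, add_comm 1] at h1
    rw [← h1, ← Finset.sum_add_distrib]
    refine Finset.sum_congr rfl fun s _ => ?_
    simp only [horizonValue, mul_add, Finset.sum_add_distrib, add_zero, Finset.mul_sum]
    rw [add_comm]
    congr 1
    exact Finset.sum_congr rfl fun a _ => by ring

lemma horizonValue_init (M : MDP S A) (π : Policy S A) (n : ℕ) :
    M.horizonValue π n M.init =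
      ∑ i ∈ Finset.range n, ∑ s, ∑ a, M.stateProb π i s * π.prob s a * M.meanReward s a := by
  have h := M.sum_stateProb_mul_horizonValue π n 0
  rw [sum_stateProb_init_mul] at h
  simpa using h

/-- The finite-horizon simulation lemma: replacing `trans` by `trans'` changes the value by at most
the sum, over the pairs visited under `M`, of the one-step errors against the values of `M'`. -/
lemma abs_sum_stateProb_mul_sub_le (M M' : MDP S A) (π : Policy S A) (Δ : S → A → ℝ)
    (hr : M'.reward = M.reward)
    (hΔ : ∀ n s a, |∑ q, (M.trans s a q - M'.trans s a q) * M'.horizonValue π n q| ≤ Δ s a)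
    (n t : ℕ) :
    |∑ s, M.stateProb π t s * (M.horizonValue π n s - M'.horizonValue π n s)| ≤
      ∑ i ∈ Finset.range n, ∑ s, ∑ a, M.stateProb π (t + i) s * π.prob s a * Δ s a := by
  induction n generalizing t with
  | zero => simp [horizonValue]
  | succ n ih =>
    rw [Finset.sum_range_succ']
    have h1 := ih (t + 1)
    rw [sum_stateProb_succ_mul] at h1
    simp only [add_assoc, add_comm 1] at h1
    have hrew : ∀ s a, M'.meanReward s a = M.meanReward s a := fun s a => by
      simp only [meanReward, hr]
    have h2 : ∑ s, M.stateProb π t s *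
          (M.horizonValue π (n + 1) s - M'.horizonValue π (n + 1) s) =
        (∑ s, M.stateProb π t s * ∑ a, π.prob s a *
          ∑ q, M.trans s a q * (M.horizonValue π n q - M'.horizonValue π n q)) +
        ∑ s, ∑ a, M.stateProb π t s * π.prob s a *
          ∑ q, (M.trans s a q - M'.trans s a q) * M'.horizonValue π n q := by
      rw [← Finset.sum_add_distrib]
      refine Finset.sum_congr rfl fun s _ => ?_
      simp only [horizonValue, hrew, mul_assoc, ← Finset.mul_sum, ← mul_add, ← mul_sub,
        ← Finset.sum_add_distrib, ← Finset.sum_sub_distrib]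
      congr 1
      refine Finset.sum_congr rfl fun a _ => ?_
      congr 1
      rw [add_sub_add_left_eq_sub, ← Finset.sum_sub_distrib]
      exact Finset.sum_congr rfl fun q _ => by ring
    rw [h2]
    refine (abs_add_le _ _).trans (add_le_add h1 ?_)
    refine (Finset.abs_sum_le_sum_abs _ _).trans (Finset.sum_le_sum fun s _ => ?_)
    refine (Finset.abs_sum_le_sum_abs _ _).trans (Finset.sum_le_sum fun a _ => ?_)
    have h0 := mul_nonneg (M.stateProb_nonneg π t s) (π.prob_nonneg s a)
    rw [abs_mul, abs_of_nonneg h0]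
    exact mul_le_mul_of_nonneg_left (hΔ n s a) h0

lemma abs_horizonValue_init_sub_le (M M' : MDP S A) (π : Policy S A) (Δ : S → A → ℝ)
    (hr : M'.reward = M.reward) (hi : M'.init = M.init)
    (hΔ : ∀ n s a, |∑ q, (M.trans s a q - M'.trans s a q) * M'.horizonValue π n q| ≤ Δ s a)
    (n : ℕ) :
    |M.horizonValue π n M.init - M'.horizonValue π n M'.init| ≤
      ∑ i ∈ Finset.range n, ∑ s, ∑ a, M.stateProb π i s * π.prob s a * Δ s a := by
  have h := M.abs_sum_stateProb_mul_sub_le M' π Δ hr hΔ n 0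
  rw [sum_stateProb_init_mul M π (fun s => M.horizonValue π n s - M'.horizonValue π n s)] at h
  simpa [hi] using h

end MDP

namespace DiscountedMDP

variable {S A : Type*} [Fintype S]

lemma trans_final_eq_zero (M : DiscountedMDP S A) (a : A) {q : S} (hq : q ≠ M.final) :
    M.trans M.final a q = 0 := by
  classical
  have h := M.trans_sum M.final a
  rw [← Finset.add_sum_erase _ _ (Finset.mem_univ M.final), M.final_absorbing] at h
  have h2 : ∑ q ∈ Finset.univ.erase M.final, M.trans M.final a q = 0 := by linarith
  exact (Finset.sum_eq_zero_iff_of_nonneg fun q _ => M.trans_nonneg _ _ _).1 h2 q (by simp [hq])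

open Classical in
lemma sum_trans_nonfinal (M : DiscountedMDP S A) {s : S} (hs : s ≠ M.final) (a : A) :
    ∑ q ∈ Finset.univ.erase M.final, M.trans s a q = M.γ := by
  have h := M.trans_sum s a
  rw [← Finset.add_sum_erase _ _ (Finset.mem_univ M.final), M.trans_final s a hs] at h
  linarith

lemma meanReward_final (M : DiscountedMDP S A) (a : A) : M.meanReward M.final a = 0 := by
  simp [MDP.meanReward, M.final_reward]

variable [Fintype A]

lemma horizonValue_final (M : DiscountedMDP S A) (π : Policy S A) (n : ℕ) :
    M.horizonValue π n M.final = 0 := by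
  induction n with
  | zero => rfl
  | succ n ih =>
    simp only [MDP.horizonValue, M.meanReward_final, zero_add]
    refine Finset.sum_eq_zero fun a _ => ?_
    rw [Finset.sum_eq_zero, mul_zero]
    intro q _
    by_cases hq : q = M.final
    · rw [hq, ih, mul_zero]
    · rw [M.trans_final_eq_zero a hq, zero_mul]

lemma horizonValue_nonneg (M : DiscountedMDP S A) (π : Policy S A) (n : ℕ) (s : S) :
    0 ≤ M.horizonValue π n s := by
  induction n generalizing s with
  | zero => exact le_rfl
  | succ n ih =>
    exact Finset.sum_nonneg fun a _ => mul_nonneg (π.prob_nonneg s a)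
      (add_nonneg (M.reward_mean_nonneg s a)
        (Finset.sum_nonneg fun q _ => mul_nonneg (M.trans_nonneg s a q) (ih q)))

lemma horizonValue_le (M : DiscountedMDP S A) (π : Policy S A) (n : ℕ) (s : S) :
    M.horizonValue π n s ≤ 1 / (1 - M.γ) := by
  classical
  have hγ : 0 < 1 - M.γ := by linarith [M.γ_lt_one]
  induction n generalizing s with
  | zero => simpa [MDP.horizonValue] using hγ.le
  | succ n ih =>
    by_cases hs : s = M.final
    · rw [hs, M.horizonValue_final]; positivity
    calc M.horizonValue π (n + 1) s
        ≤ ∑ a, π.prob s a * (1 / (1 - M.γ)) := by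
          refine Finset.sum_le_sum fun a _ => mul_le_mul_of_nonneg_left ?_ (π.prob_nonneg s a)
          rw [← Finset.add_sum_erase _ _ (Finset.mem_univ M.final), M.horizonValue_final, mul_zero,
            zero_add]
          have h : ∑ q ∈ Finset.univ.erase M.final, M.trans s a q * M.horizonValue π n q ≤
              M.γ * (1 / (1 - M.γ)) := by
            refine (Finset.sum_le_sum fun q _ =>
              mul_le_mul_of_nonneg_left (ih q) (M.trans_nonneg s a q)).trans_eq ?_
            rw [← Finset.sum_mul, M.sum_trans_nonfinal hs a]
          have h2 : M.meanReward s a ≤ 1 := M.reward_mean_le_one s a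
          have h3 : 1 + M.γ * (1 / (1 - M.γ)) = 1 / (1 - M.γ) := by field_simp; ring
          linarith
      _ = 1 / (1 - M.γ) := by rw [← Finset.sum_mul, π.prob_sum, one_mul]

open Classical in
lemma sum_stateProb_nonfinal_le (M : DiscountedMDP S A) (π : Policy S A) (t : ℕ) :
    ∑ s ∈ Finset.univ.erase M.final, M.stateProb π t s ≤ M.γ ^ t := by
  induction t with
  | zero =>
    have h := M.sum_stateProb_init_mul π (fun _ => 1)
    simp only [mul_one] at h
    rw [pow_zero, ← h]
    exact Finset.sum_le_sum_of_subset_of_nonneg (Finset.erase_subset _ _)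
      fun s _ _ => M.stateProb_nonneg π 0 s
  | succ t ih =>
    have h := M.sum_stateProb_succ_mul π t (fun q => if q = M.final then 0 else 1)
    have e : ∀ f : S → ℝ, ∑ q, f q * (if q = M.final then 0 else 1) =
        ∑ q ∈ Finset.univ.erase M.final, f q := fun f => by
      rw [← Finset.add_sum_erase _ _ (Finset.mem_univ M.final)]
      simp only [↓reduceIte, mul_zero, zero_add]
      exact Finset.sum_congr rfl fun q hq => by simp [(Finset.mem_erase.1 hq).1]
    rw [e] at h
    simp only [e] at h
    rw [h, ← Finset.add_sum_erase _ _ (Finset.mem_univ M.final)]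
    have h0 : ∀ a, ∑ q ∈ Finset.univ.erase M.final, M.trans M.final a q = 0 := fun a =>
      Finset.sum_eq_zero fun q hq => M.trans_final_eq_zero a (Finset.mem_erase.1 hq).1
    simp only [h0, mul_zero, Finset.sum_const_zero, zero_add]
    calc _ = ∑ s ∈ Finset.univ.erase M.final, M.stateProb π t s * M.γ := by
          refine Finset.sum_congr rfl fun s hs => ?_
          simp only [M.sum_trans_nonfinal (Finset.mem_erase.1 hs).1]
          rw [← Finset.sum_mul, π.prob_sum, one_mul]
      _ ≤ M.γ ^ (t + 1) := by
          rw [← Finset.sum_mul, pow_succ]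
          exact mul_le_mul_of_nonneg_right ih M.γ_pos.le

end DiscountedMDP

/-! ### The Markov property, values and occupancies -/

namespace MDP

lemma measurable_step_reward {S A : Type*} [MeasurableSpace S] [MeasurableSpace A] :
    Measurable (fun z : Step S A => z.2.2) := by fun_prop

variable {S A : Type*} [Fintype S] [Fintype A] [MeasurableSpace S] [MeasurableSpace A]

lemma lintegral_stepLaw (M : MDP S A) (π : Policy S A) (s : S) {f : Step S A → ℝ≥0∞}
    (hf : Measurable f) :
    ∫⁻ z, f z ∂(M.stepLaw π s) =
      ∑ a, ENNReal.ofReal (π.prob s a) * ∫⁻ r, f (s, a, r) ∂(M.reward s a) := by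
  rw [stepLaw, lintegral_finsetSum_measure]
  refine Finset.sum_congr rfl fun a _ => ?_
  rw [lintegral_smul_measure, lintegral_map hf (by fun_prop), smul_eq_mul]

lemma lintegral_stepLaw_fst [MeasurableSingletonClass S] (M : MDP S A) (π : Policy S A) (s : S)
    (f : S → ℝ≥0∞) :
    ∫⁻ z, f z.1 ∂(M.stepLaw π s) = f s := by
  have hp : ∀ s a, M.reward s a Set.univ = 1 := fun s a => (M.reward_prob s a).measure_univ
  rw [M.lintegral_stepLaw π s (f := fun z => f z.1)
    ((measurable_of_countable f).comp measurable_fst)]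
  simp only [lintegral_const, hp, mul_one, ← Finset.sum_mul]
  rw [← ENNReal.ofReal_sum_of_nonneg fun a _ => π.prob_nonneg s a, π.prob_sum]
  simp

lemma lintegral_nextLaw (M : MDP S A) (π : Policy S A) (s : S) (a : A) (f : Step S A → ℝ≥0∞) :
    ∫⁻ z, f z ∂(M.nextLaw π s a) =
      ∑ q, ENNReal.ofReal (M.trans s a q) * ∫⁻ z, f z ∂(M.stepLaw π q) := by
  rw [nextLaw, lintegral_finsetSum_measure]
  simp only [lintegral_smul_measure, smul_eq_mul]

lemma integrable_reward_stepLaw (M : MDP S A) (π : Policy S A) (s : S) :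
    Integrable (fun z : Step S A => z.2.2) (M.stepLaw π s) := by
  refine integrable_finsetSum_measure.2 fun a _ => ?_
  refine Integrable.smul_measure ?_ ENNReal.ofReal_ne_top
  rw [integrable_map_measure measurable_step_reward.aestronglyMeasurable (by fun_prop)]
  exact M.reward_integrable s a

lemma integral_reward_stepLaw (M : MDP S A) (π : Policy S A) (s : S) :
    ∫ z, z.2.2 ∂(M.stepLaw π s) = ∑ a, π.prob s a * M.meanReward s a := by
  have hi := M.integrable_reward_stepLaw π s
  rw [stepLaw, integral_finsetSum_measure (integrable_finsetSum_measure.1 hi)]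
  refine Finset.sum_congr rfl fun a _ => ?_
  rw [integral_smul_measure,
    integral_map (by fun_prop) measurable_step_reward.aestronglyMeasurable,
    ENNReal.toReal_ofReal (π.prob_nonneg s a), smul_eq_mul, meanReward]

variable [MeasurableSingletonClass S] [MeasurableSingletonClass A]

instance isProbabilityMeasure_pathLaw (M : MDP S A) (π : Policy S A) :
    IsProbabilityMeasure (M.pathLaw π) := by
  unfold pathLaw; infer_instance

lemma map_zero_pathLaw (M : MDP S A) (π : Policy S A) :
    (M.pathLaw π).map (fun ξ => ξ 0) = M.stepLaw π M.init := by
  have h : (fun ξ : SamplePath S A => ξ 0) =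
      (fun x : (i : Finset.Iic 0) → Step S A => x ⟨0, by simp⟩) ∘ Preorder.frestrictLe 0 := rfl
  rw [h, ← Measure.map_map (by fun_prop) (by fun_prop), pathLaw, Kernel.trajMeasure,
    Measure.map_comp _ _ (by fun_prop), Kernel.traj_map_frestrictLe]
  simp only [Kernel.partialTraj_self, Measure.id_comp]
  rw [Measure.map_map (by fun_prop) (by fun_prop)]
  exact Measure.map_id

/-- The Markov property: given the path up to time `n`, the next step has law `nextLaw`. The
hypothesis `hdep` says that `F` depends on the path only up to time `n`. -/
lemma lintegral_succ (M : MDP S A) (π : Policy S A) (n : ℕ) {F : SamplePath S A → Step S A → ℝ≥0∞}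
    (hF : Measurable (Function.uncurry F)) (hdep : ∀ ξ ξ', (∀ k ≤ n, ξ k = ξ' k) → F ξ = F ξ') :
    ∫⁻ ξ, F ξ (ξ (n + 1)) ∂(M.pathLaw π) =
      ∫⁻ ξ, ∫⁻ z, F ξ z ∂(M.nextLaw π (ξ n).1 (ξ n).2.1) ∂(M.pathLaw π) := by
  obtain ⟨a0⟩ : Nonempty A := by
    by_contra h
    rw [not_nonempty_iff] at h
    simpa using π.prob_sum M.init
  -- a path up to time `n` is extended by an arbitrary constant, on which `F` does not depend
  let ext : ((i : Finset.Iic n) → Step S A) → SamplePath S A := fun x k =>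
    if h : k ≤ n then x ⟨k, Finset.mem_Iic.2 h⟩ else (M.init, a0, 0)
  have hext : Measurable ext := by
    refine measurable_pi_lambda _ fun k => ?_
    by_cases h : k ≤ n
    · simp only [ext, h, dite_true]; fun_prop
    · simp only [ext, h, dite_false]; fun_prop
  have hG : Measurable (fun p : ((i : Finset.Iic n) → Step S A) × Step S A => F (ext p.1) p.2) :=
    hF.comp ((hext.comp measurable_fst).prodMk measurable_snd)
  have hres : ∀ ξ : SamplePath S A, F (ext (Preorder.frestrictLe n ξ)) = F ξ := fun ξ =>
    hdep _ _ fun k hk => by simp [ext, hk, Preorder.frestrictLe]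
  have key := Kernel.map_frestrictLe_trajMeasure_compProd_eq_map_trajMeasure
    (X := fun _ => Step S A)
    (μ₀ := M.stepLaw π M.init) (a := n)
    (κ := fun n => (M.stepKernel π).comap (fun h => h ⟨n, by simp⟩) (by fun_prop))
  change (M.pathLaw π).map _ ⊗ₘ _ = (M.pathLaw π).map _ at key
  have h1 := congrArg (fun ν => ∫⁻ p, F (ext p.1) p.2 ∂ν) key
  rw [lintegral_map hG (by fun_prop), Measure.lintegral_compProd hG,
    lintegral_map (by exact hG.lintegral_kernel_prod_right') (by fun_prop)] at h1
  simp only [hres] at h1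
  exact h1.symm

lemma measurable_comp_pair {β : Type*} [MeasurableSpace β] (g : S → A → β) :
    Measurable (fun z : Step S A => g z.1 z.2.1) :=
  (measurable_of_countable (Function.uncurry g)).comp
    (measurable_fst.prodMk (measurable_fst.comp measurable_snd))

lemma lintegral_eval (M : MDP S A) (π : Policy S A) (t : ℕ) {f : Step S A → ℝ≥0∞}
    (hf : Measurable f) :
    ∫⁻ ξ, f (ξ t) ∂(M.pathLaw π) =
      ∑ s, ENNReal.ofReal (M.stateProb π t s) * ∫⁻ z, f z ∂(M.stepLaw π s) := by
  classical
  induction t generalizing f with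
  | zero =>
    rw [← lintegral_map hf (measurable_pi_apply 0), map_zero_pathLaw]
    rw [Finset.sum_eq_single M.init]
    · simp [stateProb]
    · intro s _ hs
      simp [stateProb, hs]
    · simp
  | succ t ih =>
    rw [M.lintegral_succ π t (F := fun _ z => f z) (by exact hf.comp measurable_snd)
      (fun _ _ _ => rfl)]
    have hm := measurable_comp_pair (fun s (a : A) => ∫⁻ w, f w ∂(M.nextLaw π s a))
    rw [ih hm]
    simp only [M.lintegral_stepLaw π _ hm, lintegral_const]
    have hp : ∀ s a, M.reward s a Set.univ = 1 := fun s a => (M.reward_prob s a).measure_univ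
    simp only [hp, mul_one, lintegral_nextLaw, stateProb]
    have : ∀ q, ENNReal.ofReal (∑ s, ∑ a, M.stateProb π t s * π.prob s a * M.trans s a q) =
      ∑ s, ∑ a, ENNReal.ofReal (M.stateProb π t s) * ENNReal.ofReal (π.prob s a) *
        ENNReal.ofReal (M.trans s a q) := fun q => by
      have hsa : ∀ s a, 0 ≤ M.stateProb π t s * π.prob s a := fun s a =>
        mul_nonneg (M.stateProb_nonneg π t s) (π.prob_nonneg s a)
      rw [ENNReal.ofReal_sum_of_nonneg fun s _ => Finset.sum_nonneg fun a _ =>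
        mul_nonneg (hsa s a) (M.trans_nonneg s a q)]
      refine Finset.sum_congr rfl fun s _ => ?_
      rw [ENNReal.ofReal_sum_of_nonneg fun a _ => mul_nonneg (hsa s a) (M.trans_nonneg s a q)]
      refine Finset.sum_congr rfl fun a _ => ?_
      rw [ENNReal.ofReal_mul (hsa s a), ENNReal.ofReal_mul (M.stateProb_nonneg π t s)]
    simp only [this, Finset.sum_mul, Finset.mul_sum]
    symm
    rw [Finset.sum_comm]
    refine Finset.sum_congr rfl fun s _ => ?_
    rw [Finset.sum_comm]
    exact Finset.sum_congr rfl fun a _ => Finset.sum_congr rfl fun q _ => by ring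

lemma map_eval_pathLaw (M : MDP S A) (π : Policy S A) (t : ℕ) :
    (M.pathLaw π).map (fun ξ => ξ t) =
      ∑ s, ENNReal.ofReal (M.stateProb π t s) • M.stepLaw π s := by
  ext B hB
  rw [← lintegral_indicator_one hB, lintegral_map (by fun_prop (disch := exact hB))
    (by fun_prop), M.lintegral_eval π t (by fun_prop (disch := exact hB))]
  simp [lintegral_indicator_one hB, Measure.finsetSum_apply]

lemma integral_reward_eval (M : MDP S A) (π : Policy S A) (t : ℕ) :
    ∫ ξ, (ξ t).2.2 ∂(M.pathLaw π) =
      ∑ s, ∑ a, M.stateProb π t s * π.prob s a * M.meanReward s a := by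
  rw [← integral_map (φ := fun ξ : SamplePath S A => ξ t) (f := fun z : Step S A => z.2.2)
    (measurable_pi_apply t).aemeasurable measurable_step_reward.aestronglyMeasurable,
    map_eval_pathLaw, integral_finsetSum_measure fun s _ =>
    (M.integrable_reward_stepLaw π s).smul_measure ENNReal.ofReal_ne_top]
  refine Finset.sum_congr rfl fun s _ => ?_
  rw [integral_smul_measure, integral_reward_stepLaw,
    ENNReal.toReal_ofReal (M.stateProb_nonneg π t s), smul_eq_mul, Finset.mul_sum]
  exact Finset.sum_congr rfl fun a _ => by ring

open Classical in
lemma lintegral_visit (M : MDP S A) (π : Policy S A) (t : ℕ) (s : S) (a : A) :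
    ∫⁻ ξ, (if (ξ t).1 = s ∧ (ξ t).2.1 = a then 1 else 0) ∂(M.pathLaw π) =
      ENNReal.ofReal (M.stateProb π t s * π.prob s a) := by
  have hm := measurable_comp_pair (fun (s' : S) (a' : A) =>
    if s' = s ∧ a' = a then (1 : ℝ≥0∞) else 0)
  rw [M.lintegral_eval π t hm]
  have hp : ∀ s a, M.reward s a Set.univ = 1 := fun s a => (M.reward_prob s a).measure_univ
  simp only [M.lintegral_stepLaw π _ hm]
  rw [Finset.sum_eq_single s, Finset.sum_eq_single a]
  · simp [ENNReal.ofReal_mul (M.stateProb_nonneg π t s), hp]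
  · intro b _ hb; simp [hb]
  · simp
  · intro b _ hb; simp [hb]
  · simp

lemma occupancy_eq_tsum (M : MDP S A) (π : Policy S A) (s : S) (a : A) :
    M.occupancy π s a = ∑' t, ENNReal.ofReal (M.stateProb π t s * π.prob s a) := by
  classical
  rw [occupancy, lintegral_tsum]
  · exact tsum_congr fun t => by rw [← lintegral_visit]
  · intro t
    exact ((measurable_comp_pair (fun (s' : S) (a' : A) =>
      if s' = s ∧ a' = a then (1 : ℝ≥0∞) else 0)).comp (measurable_pi_apply t)).aemeasurable

end MDP

namespace DiscountedMDP

variable {S A : Type*} [Fintype S]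

lemma tsum_ofReal_γ_pow (M : DiscountedMDP S A) :
    ∑' t : ℕ, ENNReal.ofReal (M.γ ^ t) = ENNReal.ofReal (1 / (1 - M.γ)) := by
  rw [← ENNReal.ofReal_tsum_of_nonneg (fun t => pow_nonneg M.γ_pos.le t)
    (summable_geometric_of_lt_one M.γ_pos.le M.γ_lt_one),
    tsum_geometric_of_lt_one M.γ_pos.le M.γ_lt_one, one_div]

variable [Fintype A] [MeasurableSpace S] [MeasurableSpace A]
  [MeasurableSingletonClass S] [MeasurableSingletonClass A]

/-- The total reward is absolutely integrable: the final state pays nothing, and the probability of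
not having reached it by time `t` is at most `γ ^ t`. -/
lemma tsum_lintegral_reward_ne_top (M : DiscountedMDP S A) (π : Policy S A) :
    ∑' t, ∫⁻ ξ, ‖(ξ t).2.2‖ₑ ∂(M.pathLaw π) ≠ ∞ := by
  classical
  set B : ℝ≥0∞ := ∑ s, ∫⁻ z, ‖z.2.2‖ₑ ∂(M.stepLaw π s) with hB
  have hBt : B ≠ ∞ := ENNReal.sum_ne_top.2 fun s _ => (M.integrable_reward_stepLaw π s).2.ne
  have hle : ∀ t, ∫⁻ ξ, ‖(ξ t).2.2‖ₑ ∂(M.pathLaw π) ≤ ENNReal.ofReal (M.γ ^ t) * B := fun t => by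
    have hm : Measurable (fun z : Step S A => ‖z.2.2‖ₑ) := by fun_prop
    have hfin : ∫⁻ z, ‖z.2.2‖ₑ ∂(M.stepLaw π M.final) = 0 := by
      rw [M.lintegral_stepLaw π _ hm]
      simp [M.final_reward]
    rw [M.lintegral_eval π t hm, ← Finset.add_sum_erase _ _ (Finset.mem_univ M.final), hfin,
      mul_zero, zero_add]
    calc _ ≤ ∑ s ∈ Finset.univ.erase M.final, ENNReal.ofReal (M.stateProb π t s) * B :=
          Finset.sum_le_sum fun s _ => by
            gcongr
            exact Finset.single_le_sum (f := fun s => ∫⁻ z, ‖z.2.2‖ₑ ∂(M.stepLaw π s))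
              (fun _ _ => zero_le) (Finset.mem_univ s)
      _ ≤ _ := by
          rw [← Finset.sum_mul, ← ENNReal.ofReal_sum_of_nonneg fun s _ => M.stateProb_nonneg π t s]
          gcongr
          exact M.sum_stateProb_nonfinal_le π t
  refine ne_top_of_le_ne_top ?_ (ENNReal.tsum_le_tsum hle)
  rw [ENNReal.tsum_mul_right, tsum_ofReal_γ_pow]
  exact ENNReal.mul_ne_top ENNReal.ofReal_ne_top hBt

lemma tendsto_horizonValue (M : DiscountedMDP S A) (π : Policy S A) :
    Filter.Tendsto (fun n => M.horizonValue π n M.init) Filter.atTop (nhds (M.value π)) := by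
  have hv : M.value π = ∑' t, ∑ s, ∑ a, M.stateProb π t s * π.prob s a * M.meanReward s a := by
    rw [MDP.value, integral_tsum (f := fun t (ξ : SamplePath S A) => (ξ t).2.2)
      (fun t => (MDP.measurable_step_reward.comp (measurable_pi_apply t)).aestronglyMeasurable)
      (M.tsum_lintegral_reward_ne_top π)]
    exact tsum_congr fun t => M.integral_reward_eval π t
  have hnn : ∀ t, 0 ≤ ∑ s, ∑ a, M.stateProb π t s * π.prob s a * M.meanReward s a := fun t =>
    Finset.sum_nonneg fun s _ => Finset.sum_nonneg fun a _ => mul_nonneg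
      (mul_nonneg (M.stateProb_nonneg π t s) (π.prob_nonneg s a)) (M.reward_mean_nonneg s a)
  have hs : Summable fun t => ∑ s, ∑ a, M.stateProb π t s * π.prob s a * M.meanReward s a :=
    summable_of_sum_range_le hnn fun n => by
      rw [← M.horizonValue_init π n]; exact M.horizonValue_le π n _
  rw [hv]
  simpa only [M.horizonValue_init] using hs.hasSum.tendsto_sum_nat

lemma value_nonneg (M : DiscountedMDP S A) (π : Policy S A) : 0 ≤ M.value π :=
  ge_of_tendsto' (M.tendsto_horizonValue π) fun n => M.horizonValue_nonneg π n _

lemma value_le (M : DiscountedMDP S A) (π : Policy S A) : M.value π ≤ 1 / (1 - M.γ) :=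
  le_of_tendsto' (M.tendsto_horizonValue π) fun n => M.horizonValue_le π n _

open Classical in
lemma sum_occupancy_le (M : DiscountedMDP S A) (π : Policy S A) :
    ∑ s ∈ Finset.univ.erase M.final, ∑ a, M.occupancy π s a ≤ ENNReal.ofReal (1 / (1 - M.γ)) := by
  rw [← M.tsum_ofReal_γ_pow]
  simp only [M.occupancy_eq_tsum]
  have h : ∀ s, ∑ a, ∑' t, ENNReal.ofReal (M.stateProb π t s * π.prob s a) =
      ∑' t, ENNReal.ofReal (M.stateProb π t s) := fun s => by
    rw [← Summable.tsum_finsetSum fun _ _ => ENNReal.summable]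
    refine tsum_congr fun t => ?_
    rw [← ENNReal.ofReal_sum_of_nonneg fun a _ =>
      mul_nonneg (M.stateProb_nonneg π t s) (π.prob_nonneg s a), ← Finset.mul_sum, π.prob_sum,
      mul_one]
  simp only [h]
  rw [← Summable.tsum_finsetSum fun _ _ => ENNReal.summable]
  refine ENNReal.tsum_le_tsum fun t => ?_
  rw [← ENNReal.ofReal_sum_of_nonneg fun s _ => M.stateProb_nonneg π t s]
  exact ENNReal.ofReal_le_ofReal (M.sum_stateProb_nonfinal_le π t)

lemma occupancy_ne_top (M : DiscountedMDP S A) (π : Policy S A) {s : S} (hs : s ≠ M.final) (a : A) :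
    M.occupancy π s a ≠ ∞ := by
  classical
  refine ne_top_of_le_ne_top ENNReal.ofReal_ne_top (le_trans ?_ (M.sum_occupancy_le π))
  exact (Finset.single_le_sum (f := fun a => M.occupancy π s a) (fun _ _ => zero_le)
      (Finset.mem_univ a)).trans
    (Finset.single_le_sum (f := fun s => ∑ a, M.occupancy π s a) (fun _ _ => zero_le)
      (Finset.mem_erase.2 ⟨hs, Finset.mem_univ s⟩))

open Classical in
lemma sum_toReal_occupancy_le (M : DiscountedMDP S A) (π : Policy S A) :
    ∑ s ∈ Finset.univ.erase M.final, ∑ a, (M.occupancy π s a).toReal ≤ 1 / (1 - M.γ) := by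
  have hγ : 0 < 1 - M.γ := by linarith [M.γ_lt_one]
  have h := ENNReal.toReal_mono ENNReal.ofReal_ne_top (M.sum_occupancy_le π)
  rw [ENNReal.toReal_ofReal (by positivity)] at h
  refine le_trans (le_of_eq ?_) h
  rw [ENNReal.toReal_sum fun s hs => ENNReal.sum_ne_top.2 fun a _ =>
    M.occupancy_ne_top π (Finset.mem_erase.1 hs).1 a]
  refine Finset.sum_congr rfl fun s hs => ?_
  rw [ENNReal.toReal_sum fun a _ => M.occupancy_ne_top π (Finset.mem_erase.1 hs).1 a]

open Classical in
/-- The simulation lemma: the difference of the values of two models is at most the occupancy of the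
first model times the one-step errors. -/
lemma abs_value_sub_le (M M' : DiscountedMDP S A) (π : Policy S A) (Δ : S → A → ℝ)
    (hr : M'.reward = M.reward) (hi : M'.init = M.init) (hf : M'.final = M.final)
    (hΔ : ∀ n s a, s ≠ M.final →
      |∑ q, (M.trans s a q - M'.trans s a q) * M'.horizonValue π n q| ≤ Δ s a) :
    |M.value π - M'.value π| ≤
      ∑ s ∈ Finset.univ.erase M.final, ∑ a, (M.occupancy π s a).toReal * Δ s a := by
  refine le_of_tendsto' ((M.tendsto_horizonValue π).sub (M'.tendsto_horizonValue π)).abs fun n => ?_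
  have h := M.abs_horizonValue_init_sub_le M'.toMDP π
    (fun s a => if s = M.final then 0 else Δ s a) hr hi (fun n s a => ?_) n
  · refine h.trans ?_
    rw [Finset.sum_comm, ← Finset.add_sum_erase _ _ (Finset.mem_univ M.final)]
    simp only [↓reduceIte, mul_zero, Finset.sum_const_zero, zero_add]
    refine Finset.sum_le_sum fun s hs => ?_
    have hs' := (Finset.mem_erase.1 hs).1
    rw [Finset.sum_comm]
    refine Finset.sum_le_sum fun a _ => ?_
    simp only [hs', ↓reduceIte]
    rw [← Finset.sum_mul]
    refine mul_le_mul_of_nonneg_right ?_ ((abs_nonneg _).trans (hΔ 0 s a hs'))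
    have h0 : ∀ t, 0 ≤ M.stateProb π t s * π.prob s a := fun t =>
      mul_nonneg (M.stateProb_nonneg π t s) (π.prob_nonneg s a)
    rw [← ENNReal.ofReal_le_iff_le_toReal (M.occupancy_ne_top π hs' a), M.occupancy_eq_tsum,
      ENNReal.ofReal_sum_of_nonneg fun t _ => h0 t]
    exact ENNReal.sum_le_tsum _
  · by_cases hs : s = M.final
    · subst hs
      simp only [↓reduceIte, abs_nonpos_iff]
      refine Finset.sum_eq_zero fun q _ => ?_
      by_cases hq : q = M.final
      · rw [hq, ← hf, M'.horizonValue_final, mul_zero]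
      · rw [M.trans_final_eq_zero a hq, ← hf, M'.trans_final_eq_zero a (hf ▸ hq), sub_zero,
          zero_mul]
    · simpa only [hs, ↓reduceIte] using hΔ n s a hs

end DiscountedMDP

/-! ### Numbers of visits along a path -/

section Counts

variable {S A : Type*}

open Classical in
/-- The indicator that `a` is taken at `s` at time `t`. -/
noncomputable def visitInd (s : S) (a : A) (ξ : SamplePath S A) (t : ℕ) : ℝ≥0∞ :=
  if (ξ t).1 = s ∧ (ξ t).2.1 = a then 1 else 0

open Classical in
/-- The indicator that `a` is taken at `s` at time `t` and leads to `q`. -/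
noncomputable def moveInd (s : S) (a : A) (q : S) (ξ : SamplePath S A) (t : ℕ) : ℝ≥0∞ :=
  visitInd s a ξ t * if (ξ (t + 1)).1 = q then 1 else 0

/-- The number of times that `a` is taken at `s` along a path. -/
noncomputable def visitCount (s : S) (a : A) (ξ : SamplePath S A) : ℝ≥0∞ := ∑' t, visitInd s a ξ t

/-- The number of times that `a` is taken at `s` and leads to `q` along a path. -/
noncomputable def moveCount (s : S) (a : A) (q : S) (ξ : SamplePath S A) : ℝ≥0∞ :=
  ∑' t, moveInd s a q ξ t

open Classical in
/-- The indicator that `a` is taken at `s` for the first time at time `t`. -/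
noncomputable def firstVisitInd (s : S) (a : A) (ξ : SamplePath S A) (t : ℕ) : ℝ≥0∞ :=
  if visitInd s a ξ t = 1 ∧ ∀ j < t, visitInd s a ξ j = 0 then 1 else 0

lemma visitInd_eq_zero_or_one (s : S) (a : A) (ξ : SamplePath S A) (t : ℕ) :
    visitInd s a ξ t = 0 ∨ visitInd s a ξ t = 1 := by
  unfold visitInd; split_ifs <;> simp

lemma visitInd_ne_top (s : S) (a : A) (ξ : SamplePath S A) (t : ℕ) : visitInd s a ξ t ≠ ∞ := by
  rcases visitInd_eq_zero_or_one s a ξ t with h | h <;> simp [h]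

lemma visitInd_eq_one_iff (s : S) (a : A) (ξ : SamplePath S A) (t : ℕ) :
    visitInd s a ξ t = 1 ↔ (ξ t).1 = s ∧ (ξ t).2.1 = a := by
  unfold visitInd; split_ifs with h <;> simp [h]

lemma visitInd_congr (s : S) (a : A) {ξ ξ' : SamplePath S A} {t : ℕ} (h : ξ t = ξ' t) :
    visitInd s a ξ t = visitInd s a ξ' t := by unfold visitInd; rw [h]

lemma moveInd_le_visitInd (s : S) (a : A) (q : S) (ξ : SamplePath S A) (t : ℕ) :
    moveInd s a q ξ t ≤ visitInd s a ξ t := by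
  unfold moveInd; split_ifs <;> simp

lemma moveCount_le_visitCount (s : S) (a : A) (q : S) (ξ : SamplePath S A) :
    moveCount s a q ξ ≤ visitCount s a ξ :=
  ENNReal.tsum_le_tsum fun t => moveInd_le_visitInd s a q ξ t

lemma sum_moveCount [Fintype S] (s : S) (a : A) (ξ : SamplePath S A) :
    ∑ q, moveCount s a q ξ = visitCount s a ξ := by
  classical
  unfold moveCount visitCount
  rw [← Summable.tsum_finsetSum fun _ _ => ENNReal.summable]
  refine tsum_congr fun t => ?_
  simp only [moveInd, ← Finset.mul_sum]
  rw [Finset.sum_eq_single (ξ (t + 1)).1] <;> simp +contextual [eq_comm]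

lemma tsum_ite_le_eq (h : ℕ → ℝ≥0∞) (t : ℕ) :
    ∑' t', (if t ≤ t' then h t' else 0) = ∑' k, h (t + k) := by
  rw [← ENNReal.summable.sum_add_tsum_nat_add' (k := t), Finset.sum_eq_zero, zero_add]
  · simp [add_comm]
  · intro i hi; simp [Finset.mem_range.1 hi]

lemma tsum_add_le (h : ℕ → ℝ≥0∞) (t : ℕ) : ∑' k, h (t + k) ≤ ∑' t, h t := by
  rw [← tsum_ite_le_eq]
  exact ENNReal.tsum_le_tsum fun k => by split_ifs <;> simp

/-- The square of a sum is at most twice its upper triangle. -/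
lemma tsum_sq_le (h : ℕ → ℝ≥0∞) : (∑' t, h t) ^ 2 ≤ 2 * ∑' t, ∑' k, h t * h (t + k) := by
  have h1 : ∀ t, ∑' k, h t * h (t + k) = ∑' t', if t ≤ t' then h t * h t' else 0 := fun t =>
    (tsum_ite_le_eq (fun t' => h t * h t') t).symm
  have h2 : ∑' t, ∑' k, h t * h (t + k) = ∑' t, ∑' t', if t' ≤ t then h t * h t' else 0 := by
    simp only [h1]
    rw [ENNReal.tsum_comm]
    exact tsum_congr fun t => tsum_congr fun t' => by rw [mul_comm]
  rw [two_mul]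
  nth_rewrite 2 [h2]
  simp only [h1]
  rw [sq, ← ENNReal.tsum_mul_right, ← ENNReal.tsum_add]
  refine ENNReal.tsum_le_tsum fun t => ?_
  rw [← ENNReal.tsum_mul_left, ← ENNReal.tsum_add]
  refine ENNReal.tsum_le_tsum fun t' => ?_
  rcases le_total t t' with ht | ht <;> simp [ht]

lemma tsum_firstVisitInd_mul_le (s : S) (a : A) (ξ : SamplePath S A) :
    ∑' t, ∑' k, firstVisitInd s a ξ t * visitInd s a ξ (t + k) ≤ visitCount s a ξ := by
  by_cases h : ∃ t, firstVisitInd s a ξ t ≠ 0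
  · obtain ⟨t, ht⟩ := h
    have hv : ∀ u, firstVisitInd s a ξ u ≠ 0 →
        visitInd s a ξ u = 1 ∧ ∀ j < u, visitInd s a ξ j = 0 := fun u hu => by
      by_contra hc
      exact hu (by simp [firstVisitInd, hc])
    rw [tsum_eq_single t]
    · have h1 : firstVisitInd s a ξ t = 1 := by simp only [firstVisitInd, if_pos (hv t ht)]
      simp only [h1, one_mul]
      exact tsum_add_le (visitInd s a ξ) t
    · intro u hu
      have : firstVisitInd s a ξ u = 0 := by
        by_contra hc
        rcases lt_or_gt_of_ne hu with hlt | hlt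
        · have := (hv t ht).2 u hlt; rw [(hv u hc).1] at this; exact one_ne_zero this
        · have := (hv u hc).2 t hlt; rw [(hv t ht).1] at this; exact one_ne_zero this
      simp [this]
  · push Not at h
    simp [h]

lemma one_le_tsum_firstVisitInd (s : S) (a : A) (ξ : SamplePath S A)
    (h : ∃ t, (ξ t).1 = s ∧ (ξ t).2.1 = a) : 1 ≤ ∑' t, firstVisitInd s a ξ t := by
  classical
  have h' : ∃ t, visitInd s a ξ t = 1 := by simpa only [visitInd_eq_one_iff] using h
  have : firstVisitInd s a ξ (Nat.find h') = 1 :=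
    if_pos ⟨Nat.find_spec h', fun j hj =>
      (visitInd_eq_zero_or_one s a ξ j).resolve_right (Nat.find_min h' hj)⟩
  rw [← this]
  exact ENNReal.le_tsum _

section Measurability

variable [MeasurableSpace S] [MeasurableSpace A]
  [MeasurableSingletonClass S] [MeasurableSingletonClass A]

lemma measurable_visitInd (s : S) (a : A) (t : ℕ) :
    Measurable fun ξ : SamplePath S A => visitInd s a ξ t := by
  classical
  refine Measurable.ite ?_ measurable_const measurable_const
  have h1 : Measurable fun ξ : SamplePath S A => (ξ t).1 := by fun_prop
  have h2 : Measurable fun ξ : SamplePath S A => (ξ t).2.1 := by fun_prop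
  exact (h1 (measurableSet_singleton s)).inter (h2 (measurableSet_singleton a))

lemma measurable_moveInd (s : S) (a : A) (q : S) (t : ℕ) :
    Measurable fun ξ : SamplePath S A => moveInd s a q ξ t := by
  classical
  refine (measurable_visitInd s a t).mul (Measurable.ite ?_ measurable_const measurable_const)
  have h1 : Measurable fun ξ : SamplePath S A => (ξ (t + 1)).1 := by fun_prop
  exact h1 (measurableSet_singleton q)

lemma measurable_visitCount (s : S) (a : A) :
    Measurable fun ξ : SamplePath S A => visitCount s a ξ :=
  Measurable.tsum fun t => measurable_visitInd s a t

lemma measurable_moveCount (s : S) (a : A) (q : S) :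
    Measurable fun ξ : SamplePath S A => moveCount s a q ξ :=
  Measurable.tsum fun t => measurable_moveInd s a q t

lemma measurable_firstVisitInd (s : S) (a : A) (t : ℕ) :
    Measurable fun ξ : SamplePath S A => firstVisitInd s a ξ t := by
  classical
  refine Measurable.ite ?_ measurable_const measurable_const
  refine ((measurable_visitInd s a t) (measurableSet_singleton 1)).inter ?_
  have : {ξ : SamplePath S A | ∀ j < t, visitInd s a ξ j = 0} =
      ⋂ j, ⋂ (_ : j < t), (fun ξ => visitInd s a ξ j) ⁻¹' {0} := by ext; simp
  change MeasurableSet {ξ : SamplePath S A | ∀ j < t, visitInd s a ξ j = 0}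
  rw [this]
  exact MeasurableSet.iInter fun j => MeasurableSet.iInter fun _ =>
    measurable_visitInd s a j (measurableSet_singleton 0)

end Measurability

end Counts

namespace MDP

variable {S A : Type*} [Fintype S] [Fintype A] [MeasurableSpace S] [MeasurableSpace A]
  [MeasurableSingletonClass S] [MeasurableSingletonClass A]

lemma lintegral_visitCount (M : MDP S A) (π : Policy S A) (s : S) (a : A) :
    ∫⁻ ξ, visitCount s a ξ ∂(M.pathLaw π) = M.occupancy π s a := rfl

/-- The transition operator of the chain of steps, acting on functions. -/
noncomputable def stepOp (M : MDP S A) (π : Policy S A) (f : Step S A → ℝ≥0∞) (z : Step S A) :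
    ℝ≥0∞ := ∫⁻ w, f w ∂(M.nextLaw π z.1 z.2.1)

/-- The Markov property over `k` steps. -/
lemma lintegral_mul_eval_add (M : MDP S A) (π : Policy S A) (n k : ℕ) {F : SamplePath S A → ℝ≥0∞}
    (hF : Measurable F) (hdep : ∀ ξ ξ', (∀ k ≤ n, ξ k = ξ' k) → F ξ = F ξ')
    {f : Step S A → ℝ≥0∞} (hf : Measurable f) :
    ∫⁻ ξ, F ξ * f (ξ (n + k)) ∂(M.pathLaw π) =
      ∫⁻ ξ, F ξ * ((M.stepOp π)^[k] f) (ξ n) ∂(M.pathLaw π) := by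
  induction k generalizing f with
  | zero => rfl
  | succ k ih =>
    rw [Function.iterate_succ_apply, ← ih (f := M.stepOp π f)
      (measurable_comp_pair fun s (a : A) => ∫⁻ w, f w ∂(M.nextLaw π s a)), ← add_assoc,
      M.lintegral_succ π (n + k) (F := fun ξ z => F ξ * f z)
        ((hF.comp measurable_fst).mul (hf.comp measurable_snd))
        (fun ξ ξ' h => by rw [hdep ξ ξ' fun k hk => h k (by omega)])]
    exact lintegral_congr fun ξ => lintegral_const_mul _ hf

open Classical in
/-- The probability that `(s, a)` is used again `k` steps after it was used. -/
noncomputable def returnProb (M : MDP S A) (π : Policy S A) (s : S) (a : A) (k : ℕ) : ℝ≥0∞ :=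
  ((M.stepOp π)^[k] fun z => if z.1 = s ∧ z.2.1 = a then 1 else 0) (s, a, 0)

lemma lintegral_mul_visitInd_add (M : MDP S A) (π : Policy S A) (s : S) (a : A) (n k : ℕ)
    {F : SamplePath S A → ℝ≥0∞}
    (hF : Measurable F) (hdep : ∀ ξ ξ', (∀ k ≤ n, ξ k = ξ' k) → F ξ = F ξ')
    (hsupp : ∀ ξ, F ξ ≠ 0 → visitInd s a ξ n = 1) :
    ∫⁻ ξ, F ξ * visitInd s a ξ (n + k) ∂(M.pathLaw π) =
      (∫⁻ ξ, F ξ ∂(M.pathLaw π)) * M.returnProb π s a k := by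
  classical
  have h := M.lintegral_mul_eval_add π n k hF hdep
    (f := fun z => if z.1 = s ∧ z.2.1 = a then 1 else 0)
    (measurable_comp_pair fun (s' : S) (a' : A) => if s' = s ∧ a' = a then (1 : ℝ≥0∞) else 0)
  rw [← lintegral_mul_const _ hF]
  refine Eq.trans (lintegral_congr fun ξ => ?_) (h.trans (lintegral_congr fun ξ => ?_))
  · simp only [visitInd]
  · by_cases h0 : F ξ = 0
    · simp [h0]
    · obtain ⟨h1, h2⟩ := (visitInd_eq_one_iff s a ξ n).1 (hsupp ξ h0)
      congr 1
      unfold returnProb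
      cases k with
      | zero => simp [h1, h2]
      | succ k =>
        simp only [Function.iterate_succ_apply']
        rw [stepOp, stepOp, h1, h2]

/-- By the Markov property at a visit, `E[T²] ≤ 2 x G`, for the number `T` of visits, its mean `x`
and the mean number `G` of visits after (and including) a visit. -/
lemma lintegral_visitCount_sq_le (M : MDP S A) (π : Policy S A) (s : S) (a : A) :
    ∫⁻ ξ, visitCount s a ξ ^ 2 ∂(M.pathLaw π) ≤
      2 * (M.occupancy π s a * ∑' k, M.returnProb π s a k) := by
  calc _ ≤ ∫⁻ ξ, 2 * ∑' t, ∑' k, visitInd s a ξ t * visitInd s a ξ (t + k) ∂(M.pathLaw π) :=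
        lintegral_mono fun ξ => tsum_sq_le _
    _ = _ := by
        have hm : ∀ t k, Measurable fun ξ : SamplePath S A =>
            visitInd s a ξ t * visitInd s a ξ (t + k) := fun t k =>
          (measurable_visitInd s a t).mul (measurable_visitInd s a _)
        rw [lintegral_const_mul _ (Measurable.tsum fun t => Measurable.tsum (hm t)),
          lintegral_tsum fun t => (Measurable.tsum (hm t)).aemeasurable,
          ← lintegral_visitCount]
        unfold visitCount
        rw [lintegral_tsum fun t => (measurable_visitInd s a t).aemeasurable,
          ← ENNReal.tsum_mul_right]
        congr 1
        refine tsum_congr fun t => ?_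
        rw [lintegral_tsum fun k => (hm t k).aemeasurable, ← ENNReal.tsum_mul_left]
        refine tsum_congr fun k => ?_
        exact M.lintegral_mul_visitInd_add π s a t k (measurable_visitInd s a t)
          (fun ξ ξ' h => visitInd_congr s a (h t le_rfl))
          (fun ξ h => (visitInd_eq_zero_or_one s a ξ t).resolve_left h)

/-- By the Markov property at the first visit, `ρ G ≤ x`. -/
lemma reachProb_mul_tsum_returnProb_le (M : MDP S A) (π : Policy S A) (s : S) (a : A) :
    M.reachProb π s a * ∑' k, M.returnProb π s a k ≤ M.occupancy π s a := by
  have hm : ∀ t k, Measurable fun ξ : SamplePath S A =>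
      firstVisitInd s a ξ t * visitInd s a ξ (t + k) := fun t k =>
    (measurable_firstVisitInd s a t).mul (measurable_visitInd s a _)
  have h1 : M.reachProb π s a ≤ ∑' t, ∫⁻ ξ, firstVisitInd s a ξ t ∂(M.pathLaw π) := by
    rw [← lintegral_tsum fun t => (measurable_firstVisitInd s a t).aemeasurable]
    have hset : MeasurableSet {ξ : SamplePath S A | ∃ t, (ξ t).1 = s ∧ (ξ t).2.1 = a} := by
      have : {ξ : SamplePath S A | ∃ t, (ξ t).1 = s ∧ (ξ t).2.1 = a} =
          ⋃ t, (fun ξ => visitInd s a ξ t) ⁻¹' {1} := by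
        ext; simp [visitInd_eq_one_iff]
      exact this ▸ MeasurableSet.iUnion fun t =>
        measurable_visitInd s a t (measurableSet_singleton 1)
    rw [reachProb, ← lintegral_indicator_one hset]
    refine lintegral_mono fun ξ => ?_
    by_cases h : ξ ∈ {ξ : SamplePath S A | ∃ t, (ξ t).1 = s ∧ (ξ t).2.1 = a}
    · rw [Set.indicator_of_mem h]
      exact one_le_tsum_firstVisitInd s a ξ h
    · rw [Set.indicator_of_notMem h]
      exact zero_le
  calc _ ≤ (∑' t, ∫⁻ ξ, firstVisitInd s a ξ t ∂(M.pathLaw π)) * ∑' k, M.returnProb π s a k := by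
        gcongr
    _ = ∫⁻ ξ, ∑' t, ∑' k, firstVisitInd s a ξ t * visitInd s a ξ (t + k) ∂(M.pathLaw π) := by
        rw [lintegral_tsum fun t => (Measurable.tsum (hm t)).aemeasurable,
          ← ENNReal.tsum_mul_right]
        refine tsum_congr fun t => ?_
        rw [lintegral_tsum fun k => (hm t k).aemeasurable, ← ENNReal.tsum_mul_left]
        refine tsum_congr fun k => ?_
        refine (M.lintegral_mul_visitInd_add π s a t k (measurable_firstVisitInd s a t)
          (fun ξ ξ' h => ?_) (fun ξ h => ?_)).symm
        · simp only [firstVisitInd, visitInd_congr s a (h t le_rfl)]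
          have : ∀ j < t, visitInd s a ξ j = visitInd s a ξ' j := fun j hj =>
            visitInd_congr s a (h j hj.le)
          simp +contextual only [this]
        · by_contra hc
          exact h (by simp [firstVisitInd, hc])
    _ ≤ ∫⁻ ξ, visitCount s a ξ ∂(M.pathLaw π) :=
        lintegral_mono fun ξ => tsum_firstVisitInd_mul_le s a ξ
    _ = M.occupancy π s a := rfl

end MDP

/-! ### Exponential moments of the counts -/

/-- The exponential moment at a negative parameter of a nonnegative random variable is controlled by
its first two moments, by `exp (-y) ≤ 1 - y + y ^ 2` for `y ≥ 0`. -/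
lemma integral_exp_neg_mul_le {Ω : Type*} [MeasurableSpace Ω] {μ : Measure Ω}
    [IsProbabilityMeasure μ]
    {X : Ω → ℝ} (hX : Integrable X μ) (hX2 : Integrable (fun ω => X ω ^ 2) μ) (h0 : ∀ ω, 0 ≤ X ω)
    {l : ℝ} (hl : 0 ≤ l) :
    ∫ ω, Real.exp (-l * X ω) ∂μ ≤
      Real.exp (-l * ∫ ω, X ω ∂μ + l ^ 2 * ∫ ω, X ω ^ 2 ∂μ) := by
  have hpt : ∀ ω, Real.exp (-l * X ω) ≤ 1 + (-l * X ω + l ^ 2 * X ω ^ 2) := fun ω => by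
    have hy : 0 ≤ l * X ω := mul_nonneg hl (h0 ω)
    rcases le_total (l * X ω) 1 with h1 | h1
    · have h2 := Real.abs_exp_sub_one_sub_id_le (x := -(l * X ω))
        (by rw [abs_neg, abs_of_nonneg hy]; exact h1)
      have h3 := (abs_le.1 h2).2
      rw [neg_mul]
      nlinarith
    · have h2 : Real.exp (-l * X ω) ≤ 1 := Real.exp_le_one_iff.2 (by linarith)
      nlinarith
  have hi : Integrable (fun ω => -l * X ω + l ^ 2 * X ω ^ 2) μ :=
    (hX.const_mul _).add (hX2.const_mul _)
  calc _ ≤ ∫ ω, (1 + (-l * X ω + l ^ 2 * X ω ^ 2)) ∂μ := by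
        refine integral_mono_of_nonneg (Filter.Eventually.of_forall fun _ => (Real.exp_pos _).le) ?_
          (Filter.Eventually.of_forall hpt)
        exact (integrable_const 1).add hi
    _ = 1 + (-l * ∫ ω, X ω ∂μ + l ^ 2 * ∫ ω, X ω ^ 2 ∂μ) := by
        rw [integral_add (integrable_const 1) hi, integral_add (hX.const_mul _) (hX2.const_mul _),
          integral_const_mul, integral_const_mul]
        simp
    _ ≤ _ := by rw [add_comm]; exact Real.add_one_le_exp _

/-- The Chernoff bound for a sum of i.i.d. terms. -/
lemma measure_le_sum_le_exp {Ω 𝓧 : Type*} [MeasurableSpace Ω] [MeasurableSpace 𝓧] {μ : Measure Ω}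
    {P : Measure 𝓧} {N : ℕ} {ξ : Fin N → Ω → 𝓧} (hind : iIndepFun ξ μ)
    (hlaw : ∀ i, HasLaw (ξ i) P μ) {g : 𝓧 → ℝ} (hg : Measurable g) {c : ℝ}
    (hc : ∫⁻ x, ENNReal.ofReal (Real.exp (g x)) ∂P ≤ ENNReal.ofReal (Real.exp c)) (L : ℝ) :
    μ {ω | L ≤ ∑ i, g (ξ i ω)} ≤ ENNReal.ofReal (Real.exp (N * c - L)) := by
  set h : 𝓧 → ℝ≥0∞ := fun x => ENNReal.ofReal (Real.exp (g x)) with hh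
  have hm : Measurable h := by fun_prop
  have hae : ∀ i, AEMeasurable (fun ω => h (ξ i ω)) μ := fun i =>
    hm.comp_aemeasurable (hlaw i).aemeasurable
  have hind' : iIndepFun (fun i => (hae i).mk _) μ :=
    (hind.comp (fun _ => h) (fun _ => hm)).congr fun i => (hae i).ae_eq_mk
  have hprod : ∀ᵐ ω ∂μ, ∏ i, h (ξ i ω) = ∏ i, (hae i).mk _ ω := by
    filter_upwards [ae_all_iff.2 fun i => (hae i).ae_eq_mk] with ω hω
    exact Finset.prod_congr rfl fun i _ => hω i
  have hle : ∫⁻ ω, ∏ i, h (ξ i ω) ∂μ ≤ ENNReal.ofReal (Real.exp (N * c)) := by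
    rw [lintegral_congr_ae hprod, lintegral_prod_eq_prod_lintegral_of_indepFun Finset.univ _ hind'
      fun i => (hae i).measurable_mk]
    calc _ ≤ ∏ _i : Fin N, ENNReal.ofReal (Real.exp c) := by
          refine Finset.prod_le_prod' fun i _ => ?_
          rw [← lintegral_congr_ae (hae i).ae_eq_mk,
            ← lintegral_map' hm.aemeasurable (hlaw i).aemeasurable, (hlaw i).map_eq]
          exact hc
      _ = _ := by
          rw [Finset.prod_const, ← ENNReal.ofReal_pow (Real.exp_pos _).le, ← Real.exp_nat_mul]
          simp
  have hset : {ω | L ≤ ∑ i, g (ξ i ω)} = {ω | ENNReal.ofReal (Real.exp L) ≤ ∏ i, h (ξ i ω)} := by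
    ext ω
    simp only [Set.mem_ofPred_eq, hh]
    rw [← ENNReal.ofReal_prod_of_nonneg fun i _ => (Real.exp_pos _).le, ← Real.exp_sum,
      ENNReal.ofReal_le_ofReal_iff (Real.exp_pos _).le, Real.exp_le_exp]
  have hmk := mul_meas_ge_le_lintegral₀ (μ := μ) (f := fun ω => ∏ i, h (ξ i ω))
    (Finset.aemeasurable_fun_prod _ fun i _ => hae i) (ENNReal.ofReal (Real.exp L))
  rw [hset, Real.exp_sub, ENNReal.ofReal_div_of_pos (Real.exp_pos _)]
  rw [ENNReal.le_div_iff_mul_le (Or.inl (by simp [Real.exp_pos])) (Or.inl ENNReal.ofReal_ne_top),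
    mul_comm]
  exact hmk.trans hle

namespace DiscountedMDP

variable {S A : Type*} [Fintype S] [MeasurableSpace S] [MeasurableSpace A]
  [MeasurableSingletonClass S]

open Classical in
/-- The one-step estimate behind the Bernstein bound: a Bernoulli variable of mean `p` satisfies
`E exp (l X) ≤ exp (p (l + l ^ 2))` for `|l| ≤ 1`. -/
lemma lintegral_exp_nextLaw_le [Fintype A] (M : DiscountedMDP S A) (π : Policy S A) (s : S) (a : A)
    (q : S) {l : ℝ} (hl : |l| ≤ 1) :
    ∫⁻ z, ENNReal.ofReal (Real.exp (l * (if z.1 = q then 1 else 0) -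
      M.trans s a q * (l + l ^ 2))) ∂(M.nextLaw π s a) ≤ 1 := by
  -- the next step enters only through its state, whose law is `trans s a`
  have h1 : ∀ q', ∫⁻ z, ENNReal.ofReal (Real.exp (l * (if z.1 = q then 1 else 0) -
      M.trans s a q * (l + l ^ 2))) ∂(M.stepLaw π q') = ENNReal.ofReal (Real.exp
      (l * (if q' = q then 1 else 0) - M.trans s a q * (l + l ^ 2))) := fun q' =>
    M.lintegral_stepLaw_fst π q' (fun q' => ENNReal.ofReal (Real.exp
      (l * (if q' = q then 1 else 0) - M.trans s a q * (l + l ^ 2))))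
  rw [M.lintegral_nextLaw]
  simp only [h1]
  simp only [← ENNReal.ofReal_mul (M.trans_nonneg s a _)]
  rw [← ENNReal.ofReal_sum_of_nonneg fun q' _ =>
    mul_nonneg (M.trans_nonneg s a q') (Real.exp_pos _).le, ENNReal.ofReal_le_one]
  set p := M.trans s a q
  have hp0 : 0 ≤ p := M.trans_nonneg s a q
  have hsum : ∑ q' ∈ Finset.univ.erase q, M.trans s a q' = 1 - p := by
    have := M.trans_sum s a
    rw [← Finset.add_sum_erase _ _ (Finset.mem_univ q)] at this
    linarith
  rw [← Finset.add_sum_erase _ _ (Finset.mem_univ q)]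
  have h2 : ∑ q' ∈ Finset.univ.erase q, M.trans s a q' *
      Real.exp (l * (if q' = q then 1 else 0) - p * (l + l ^ 2)) =
      (1 - p) * Real.exp (- (p * (l + l ^ 2))) := by
    rw [← hsum, Finset.sum_mul]
    refine Finset.sum_congr rfl fun q' hq' => ?_
    simp [(Finset.mem_erase.1 hq').1]
  rw [h2]
  simp only [↓reduceIte, mul_one]
  rw [sub_eq_add_neg, Real.exp_add, ← mul_assoc, ← add_mul, Real.exp_neg,
    ← div_eq_mul_inv, div_le_one (Real.exp_pos _)]
  have h3 := (abs_le.1 (Real.abs_exp_sub_one_sub_id_le hl)).2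
  have h4 := Real.add_one_le_exp (p * (l + l ^ 2))
  nlinarith

variable [MeasurableSingletonClass A]

/-- The exponent of the supermartingale that controls the moves from `(s, a)` to `q`. -/
noncomputable def moveExponent (M : DiscountedMDP S A) (s : S) (a : A) (q : S) (l : ℝ)
    (ξ : SamplePath S A) (n : ℕ) : ℝ :=
  ∑ t ∈ Finset.range n, (l * (moveInd s a q ξ t).toReal -
    M.trans s a q * (l + l ^ 2) * (visitInd s a ξ t).toReal)

lemma measurable_moveExponent (M : DiscountedMDP S A) (s : S) (a : A) (q : S) (l : ℝ) (n : ℕ) :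
    Measurable fun ξ => M.moveExponent s a q l ξ n :=
  Finset.measurable_fun_sum _ fun t _ =>
    ((measurable_moveInd s a q t).ennreal_toReal.const_mul _).sub
    ((measurable_visitInd s a t).ennreal_toReal.const_mul _)

variable [Fintype A]

lemma ae_visitCount_lt_top (M : DiscountedMDP S A) (π : Policy S A) {s : S} (hs : s ≠ M.final)
    (a : A) : ∀ᵐ ξ ∂(M.pathLaw π), visitCount s a ξ < ∞ :=
  ae_lt_top (measurable_visitCount s a) (M.occupancy_ne_top π hs a)

/-- The exponential moment that controls the lower tail of the number of visits. The second moment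
enters through `E[T²] ≤ 2 x G` and `ρ G ≤ x`. -/
lemma lintegral_exp_neg_visitCount_le (M : DiscountedMDP S A) (π : Policy S A) {s : S}
    (hs : s ≠ M.final) (a : A) (hρ : M.reachProb π s a ≠ 0) {l : ℝ} (hl : 0 ≤ l) :
    ∫⁻ ξ, ENNReal.ofReal (Real.exp (-l * (visitCount s a ξ).toReal)) ∂(M.pathLaw π) ≤
      ENNReal.ofReal (Real.exp (-l * (M.occupancy π s a).toReal + l ^ 2 *
        (2 * (M.occupancy π s a).toReal ^ 2 / (M.reachProb π s a).toReal))) := by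
  have hρt : M.reachProb π s a ≠ ∞ := measure_ne_top _ _
  have hxt := M.occupancy_ne_top π hs a
  have hm : Measurable fun ξ : SamplePath S A => (visitCount s a ξ).toReal :=
    (measurable_visitCount s a).ennreal_toReal
  have hfin := M.ae_visitCount_lt_top π hs a
  have hsq : ∫⁻ ξ, visitCount s a ξ ^ 2 ∂(M.pathLaw π) ≤
      2 * (M.occupancy π s a * (M.occupancy π s a / M.reachProb π s a)) := by
    refine (M.lintegral_visitCount_sq_le π s a).trans ?_
    gcongr
    rw [ENNReal.le_div_iff_mul_le (Or.inl hρ) (Or.inl hρt), mul_comm]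
    exact M.reachProb_mul_tsum_returnProb_le π s a
  have hsqt : ∫⁻ ξ, visitCount s a ξ ^ 2 ∂(M.pathLaw π) ≠ ∞ :=
    ne_top_of_le_ne_top (ENNReal.mul_ne_top (by simp)
      (ENNReal.mul_ne_top hxt (ENNReal.div_ne_top hxt hρ))) hsq
  have hX : Integrable (fun ξ => (visitCount s a ξ).toReal) (M.pathLaw π) :=
    integrable_toReal_of_lintegral_ne_top (measurable_visitCount s a).aemeasurable hxt
  have hX2 : Integrable (fun ξ => (visitCount s a ξ).toReal ^ 2) (M.pathLaw π) := by
    simp only [← ENNReal.toReal_pow]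
    exact integrable_toReal_of_lintegral_ne_top
      ((measurable_visitCount s a).pow_const 2).aemeasurable hsqt
  have e1 : ∫ ξ, (visitCount s a ξ).toReal ∂(M.pathLaw π) = (M.occupancy π s a).toReal :=
    integral_toReal (measurable_visitCount s a).aemeasurable hfin
  have e2 : ∫ ξ, (visitCount s a ξ).toReal ^ 2 ∂(M.pathLaw π) ≤
      2 * (M.occupancy π s a).toReal ^ 2 / (M.reachProb π s a).toReal := by
    simp only [← ENNReal.toReal_pow]
    rw [integral_toReal ((measurable_visitCount s a).pow_const 2).aemeasurable
      (by filter_upwards [hfin] with ξ h using ENNReal.pow_lt_top h)]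
    refine (ENNReal.toReal_mono (ENNReal.mul_ne_top (by simp)
      (ENNReal.mul_ne_top hxt (ENNReal.div_ne_top hxt hρ))) hsq).trans_eq ?_
    simp only [ENNReal.toReal_mul, ENNReal.toReal_div, ENNReal.toReal_ofNat, ENNReal.toReal_pow]
    ring
  rw [← ofReal_integral_eq_lintegral_ofReal]
  · refine ENNReal.ofReal_le_ofReal
      ((integral_exp_neg_mul_le hX hX2 (fun _ => ENNReal.toReal_nonneg) hl).trans ?_)
    rw [e1]
    gcongr
  · refine Integrable.of_bound (C := 1) (hm.const_mul _).exp.aestronglyMeasurable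
      (Filter.Eventually.of_forall fun ξ => ?_)
    rw [Real.norm_of_nonneg (Real.exp_pos _).le, Real.exp_le_one_iff]
    exact mul_nonpos_of_nonpos_of_nonneg (by linarith) ENNReal.toReal_nonneg
  · exact Filter.Eventually.of_forall fun ξ => (Real.exp_pos _).le

/-- The supermartingale property, integrated. -/
lemma lintegral_exp_moveExponent_le (M : DiscountedMDP S A) (π : Policy S A) (s : S) (a : A) (q : S)
    {l : ℝ} (hl : |l| ≤ 1) (n : ℕ) :
    ∫⁻ ξ, ENNReal.ofReal (Real.exp (M.moveExponent s a q l ξ n)) ∂(M.pathLaw π) ≤ 1 := by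
  classical
  induction n with
  | zero => simp [moveExponent]
  | succ n ih =>
    refine le_trans ?_ ih
    set e : ℝ → ℝ≥0∞ := fun x => ENNReal.ofReal (Real.exp x)
    have hmq : Measurable fun z : Step S A => (if z.1 = q then (1 : ℝ) else 0) :=
      (measurable_of_countable fun s : S => if s = q then (1 : ℝ) else 0).comp measurable_fst
    have hF : Measurable (Function.uncurry fun (ξ : SamplePath S A) (z : Step S A) =>
        e (M.moveExponent s a q l ξ n) * e ((visitInd s a ξ n).toReal *
          (l * (if z.1 = q then 1 else 0) - M.trans s a q * (l + l ^ 2)))) := by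
      have h1 : Measurable fun p : SamplePath S A × Step S A => M.moveExponent s a q l p.1 n :=
        (M.measurable_moveExponent s a q l n).comp measurable_fst
      have h2 : Measurable fun p : SamplePath S A × Step S A => (visitInd s a p.1 n).toReal :=
        (measurable_visitInd s a n).ennreal_toReal.comp measurable_fst
      have h3 : Measurable fun p : SamplePath S A × Step S A =>
          (if p.2.1 = q then (1 : ℝ) else 0) :=
        hmq.comp measurable_snd
      exact h1.exp.ennreal_ofReal.mul
        (h2.mul ((h3.const_mul l).sub_const _)).exp.ennreal_ofReal
    have hstep := M.lintegral_succ π n hF fun ξ ξ' h => by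
      have hv : ∀ t ≤ n, visitInd s a ξ t = visitInd s a ξ' t := fun t ht =>
        visitInd_congr s a (h t ht)
      have hA : M.moveExponent s a q l ξ n = M.moveExponent s a q l ξ' n := by
        refine Finset.sum_congr rfl fun t ht => ?_
        have ht' := Finset.mem_range.1 ht
        unfold moveInd
        rw [hv t ht'.le, h (t + 1) ht']
      simp only [hA, hv n le_rfl]
    calc _ = ∫⁻ ξ, e (M.moveExponent s a q l ξ n) * e ((visitInd s a ξ n).toReal *
          (l * (if (ξ (n + 1)).1 = q then 1 else 0) - M.trans s a q * (l + l ^ 2)))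
          ∂(M.pathLaw π) := by
          refine lintegral_congr fun ξ => ?_
          simp only [e]
          rw [← ENNReal.ofReal_mul (Real.exp_pos _).le, ← Real.exp_add]
          congr 2
          rw [moveExponent, Finset.sum_range_succ, ← moveExponent, moveInd, ENNReal.toReal_mul]
          split_ifs <;> simp <;> ring
      _ ≤ ∫⁻ ξ, e (M.moveExponent s a q l ξ n) ∂(M.pathLaw π) := by
          rw [hstep]
          refine lintegral_mono fun ξ => ?_
          rw [lintegral_const_mul']
          · refine mul_le_of_le_one_right zero_le ?_
            rcases visitInd_eq_zero_or_one s a ξ n with h0 | h1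
            · simp [h0, e]
            · obtain ⟨h2, h3⟩ := (visitInd_eq_one_iff s a ξ n).1 h1
              simp only [h1, h2, h3, ENNReal.toReal_one, one_mul]
              exact M.lintegral_exp_nextLaw_le π s a q hl
          · exact ENNReal.ofReal_ne_top

/-- The exponential moment of the deviation of the number of moves from its compensator, with a
variance term of the Bernstein type. -/
lemma lintegral_exp_moveCount_le (M : DiscountedMDP S A) (π : Policy S A) {s : S}
    (hs : s ≠ M.final) (a : A) (q : S) {l : ℝ} (hl : |l| ≤ 1) :
    ∫⁻ ξ, ENNReal.ofReal (Real.exp (l * (moveCount s a q ξ).toReal -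
      M.trans s a q * (l + l ^ 2) * (visitCount s a ξ).toReal)) ∂(M.pathLaw π) ≤ 1 := by
  have hlim : ∀ᵐ ξ ∂(M.pathLaw π), ENNReal.ofReal (Real.exp (l * (moveCount s a q ξ).toReal -
      M.trans s a q * (l + l ^ 2) * (visitCount s a ξ).toReal)) =
      Filter.liminf (fun n => ENNReal.ofReal (Real.exp (M.moveExponent s a q l ξ n)))
        Filter.atTop := by
    filter_upwards [M.ae_visitCount_lt_top π hs a] with ξ hξ
    have h1 : HasSum (fun t => (visitInd s a ξ t).toReal) (visitCount s a ξ).toReal := by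
      rw [visitCount, ENNReal.tsum_toReal_eq fun t => visitInd_ne_top s a ξ t]
      exact ENNReal.hasSum_toReal hξ.ne
    have h2 : HasSum (fun t => (moveInd s a q ξ t).toReal) (moveCount s a q ξ).toReal := by
      rw [moveCount, ENNReal.tsum_toReal_eq fun t =>
        ne_top_of_le_ne_top (visitInd_ne_top s a ξ t) (moveInd_le_visitInd s a q ξ t)]
      exact ENNReal.hasSum_toReal ((moveCount_le_visitCount s a q ξ).trans_lt hξ).ne
    have h3 := ((h2.mul_left l).sub (h1.mul_left (M.trans s a q * (l + l ^ 2)))).tendsto_sum_nat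
    exact ((ENNReal.continuous_ofReal.comp Real.continuous_exp).continuousAt.tendsto.comp
      h3).liminf_eq.symm
  rw [lintegral_congr_ae hlim]
  refine (lintegral_liminf_le fun n =>
    (M.measurable_moveExponent s a q l n).exp.ennreal_ofReal).trans ?_
  refine (Filter.liminf_le_liminf (Filter.Eventually.of_forall fun n =>
    M.lintegral_exp_moveExponent_le π s a q hl n)).trans ?_
  simp

end DiscountedMDP

/-! ### The error of an estimated row -/

/-- Projection onto a convex set does not increase the distance to the points of the set. -/
lemma sum_sq_sub_le_of_isMinOn {ι : Type*} [Fintype ι] {K : Set (ι → ℝ)} (hK : Convex ℝ K)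
    {f p x : ι → ℝ} (hp : p ∈ K) (hx : x ∈ K) (hmin : IsMinOn (fun p => ∑ i, (p i - f i) ^ 2) K p) :
    ∑ i, (p i - x i) ^ 2 ≤ ∑ i, (f i - x i) ^ 2 := by
  set B := ∑ i, (p i - f i) * (x i - p i) with hB
  set D := ∑ i, (x i - p i) ^ 2 with hD
  have hD0 : 0 ≤ D := Finset.sum_nonneg fun i _ => sq_nonneg _
  have hquad : ∀ t ∈ Set.Icc (0 : ℝ) 1, 0 ≤ t * (2 * B + t * D) := fun t ht => by
    have h1 := isMinOn_iff.1 hmin (p + t • (x - p)) (hK.add_smul_sub_mem hp hx ht)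
    have h2 : ∑ i, ((p + t • (x - p)) i - f i) ^ 2 =
        ∑ i, (p i - f i) ^ 2 + t * (2 * B + t * D) := by
      rw [hB, hD]
      simp only [Finset.mul_sum, ← Finset.sum_add_distrib]
      refine Finset.sum_congr rfl fun i _ => ?_
      simp only [Pi.add_apply, Pi.smul_apply, Pi.sub_apply, smul_eq_mul]
      ring
    linarith
  have hB0 : 0 ≤ B := by
    by_contra hneg
    push Not at hneg
    have hDB : 0 < D - B := by linarith
    have ht1 : -B / (D - B) ≤ 1 := by rw [div_le_one hDB]; linarith
    have ht0 : 0 < -B / (D - B) := by apply div_pos <;> linarith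
    have h1 := nonneg_of_mul_nonneg_right (hquad _ ⟨ht0.le, ht1⟩) ht0
    have h2 : -B / (D - B) * D ≤ -B := by
      rw [div_mul_eq_mul_div, div_le_iff₀ hDB]
      nlinarith
    linarith
  have h3 : ∑ i, (f i - x i) ^ 2 = ∑ i, (p i - f i) ^ 2 + 2 * B + ∑ i, (p i - x i) ^ 2 := by
    rw [hB]
    simp only [Finset.mul_sum, ← Finset.sum_add_distrib]
    exact Finset.sum_congr rfl fun i _ => by ring
  have h4 : 0 ≤ ∑ i, (p i - f i) ^ 2 := Finset.sum_nonneg fun i _ => sq_nonneg _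
  linarith

/-- The parameter of the exponential moment that is optimal for a sample of size `n₀` from a
Bernoulli variable of mean `p` at confidence `exp (-L)`. -/
noncomputable def tilt (n₀ p L : ℝ) : ℝ := if n₀ * p ≤ L then 1 else √(L / (n₀ * p))

lemma tilt_pos {n₀ p L : ℝ} (hL : 0 < L) : 0 < tilt n₀ p L := by
  unfold tilt
  split_ifs with h
  · exact one_pos
  · exact Real.sqrt_pos.2 (div_pos hL (by linarith))

lemma tilt_le_one {n₀ p L : ℝ} (hL : 0 < L) : tilt n₀ p L ≤ 1 := by
  unfold tilt
  split_ifs with h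
  · exact le_rfl
  · rw [Real.sqrt_le_one, div_le_one (by linarith)]
    linarith

/-- The Bernstein deviation bound. It holds for every sample size `n ≥ n₀`, although the tilt is
that of `n₀`, so that no union bound over the random sample size is needed. -/
lemma sq_div_sub_le {n₀ n p L m : ℝ} (hn₀ : 0 < n₀) (hn : n₀ ≤ n) (hp : 0 ≤ p) (hL : 0 < L)
    (h1 : tilt n₀ p L * (m - p * n) - p * tilt n₀ p L ^ 2 * n ≤ L)
    (h2 : -tilt n₀ p L * (m - p * n) - p * tilt n₀ p L ^ 2 * n ≤ L) :
    (m / n - p) ^ 2 ≤ 4 * p * (L / n₀) + 4 * (L / n₀) ^ 2 := by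
  have hnpos : 0 < n := hn₀.trans_le hn
  have htpos : 0 < tilt n₀ p L := tilt_pos hL
  have habs : |m / n - p| ≤ p * tilt n₀ p L + L / n₀ / tilt n₀ p L := by
    have e : m / n - p = (m - p * n) / n := by field_simp
    have h3 : tilt n₀ p L * |m - p * n| ≤ p * tilt n₀ p L ^ 2 * n + L := by
      rcases abs_cases (m - p * n) with ⟨h, _⟩ | ⟨h, _⟩ <;> rw [h] <;> linarith
    rw [e, abs_div, abs_of_pos hnpos]
    calc |m - p * n| / n ≤ (p * tilt n₀ p L ^ 2 * n + L) / tilt n₀ p L / n := by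
          gcongr
          rw [le_div_iff₀ htpos]; linarith
      _ = p * tilt n₀ p L + L / n / tilt n₀ p L := by field_simp
      _ ≤ _ := by gcongr
  have hr : 0 ≤ L / n₀ := by positivity
  have hsq : (m / n - p) ^ 2 ≤ (p * tilt n₀ p L + L / n₀ / tilt n₀ p L) ^ 2 := by
    rw [← sq_abs]; gcongr
  refine hsq.trans ?_
  by_cases hc : n₀ * p ≤ L
  · have hpr : p ≤ L / n₀ := by rw [le_div_iff₀ hn₀]; linarith
    simp only [tilt, hc, ↓reduceIte, mul_one, div_one]
    nlinarith
  · have hpp : 0 < n₀ * p := by linarith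
    have hp' : 0 < p := pos_of_mul_pos_right hpp hn₀.le
    have ht2 : tilt n₀ p L ^ 2 = L / (n₀ * p) := by
      simp only [tilt, hc, ↓reduceIte]; rw [Real.sq_sqrt]; positivity
    have e : p * tilt n₀ p L + L / n₀ / tilt n₀ p L = 2 * p * tilt n₀ p L := by
      rw [eq_comm, ← sub_eq_iff_eq_add', eq_div_iff htpos.ne']
      have : (2 * p * tilt n₀ p L - p * tilt n₀ p L) * tilt n₀ p L = p * tilt n₀ p L ^ 2 := by ring
      rw [this, ht2]; field_simp
    rw [e, mul_pow, ht2]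
    have e2 : (2 * p) ^ 2 * (L / (n₀ * p)) = 4 * p * (L / n₀) := by field_simp; ring
    rw [e2]
    nlinarith [sq_nonneg (L / n₀)]

lemma transCount_eq_sum {S A : Type*} {N : ℕ} (ξ : Fin N → SamplePath S A) (s : S) (a : A) (q : S)
    (h : ∀ i, visitCount s a (ξ i) < ∞) :
    (transCount ξ s a q : ℝ) = ∑ i, (moveCount s a q (ξ i)).toReal := by
  classical
  have hfin : ∀ i, moveCount s a q (ξ i) ≠ ∞ := fun i =>
    ((moveCount_le_visitCount s a q (ξ i)).trans_lt (h i)).ne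
  set B : Set (Fin N × ℕ) := {p : Fin N × ℕ |
    (ξ p.1 p.2).1 = s ∧ (ξ p.1 p.2).2.1 = a ∧ (ξ p.1 (p.2 + 1)).1 = q} with hBdef
  have h1 : ((B.encard : ℕ∞) : ℝ≥0∞) = ∑ i, moveCount s a q (ξ i) := by
    rw [← ENNReal.tsum_set_one, tsum_subtype B (fun _ => (1 : ℝ≥0∞)), ENNReal.tsum_prod',
      tsum_fintype]
    refine Finset.sum_congr rfl fun i _ => tsum_congr fun t => ?_
    simp only [Set.indicator_apply, hBdef, Set.mem_ofPred_eq, moveInd, visitInd]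
    split_ifs <;> simp_all
  rw [← ENNReal.toReal_sum fun i _ => hfin i, ← h1]
  have hB : B.Finite := by
    rw [← Set.encard_ne_top_iff]
    intro ht
    rw [ht] at h1
    exact ENNReal.sum_ne_top.2 (fun i _ => hfin i) h1.symm
  rw [transCount, ← hBdef, ← hB.cast_ncard_eq]
  simp

namespace DiscountedMDP

variable {S A : Type*} [Fintype S]

lemma convex_feasibleRows (M : DiscountedMDP S A) : Convex ℝ M.feasibleRows := by
  refine (convex_stdSimplex ℝ S).inter fun p hp q hq x y _ _ hxy => ?_
  have hp' : p M.final = 1 - M.γ := hp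
  have hq' : q M.final = 1 - M.γ := hq
  change x * p M.final + y * q M.final = 1 - M.γ
  rw [hp', hq', ← add_mul, hxy, one_mul]

lemma trans_mem_feasibleRows (M : DiscountedMDP S A) {s : S} (hs : s ≠ M.final) (a : A) :
    M.trans s a ∈ M.feasibleRows :=
  ⟨⟨M.trans_nonneg s a, M.trans_sum s a⟩, M.trans_final s a hs⟩

lemma estTrans_mem_feasibleRows (M : DiscountedMDP S A) {N : ℕ} (ξ : Fin N → SamplePath S A)
    {s : S} (hs : s ≠ M.final) (a : A) : M.estTrans ξ s a ∈ M.feasibleRows := by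
  refine ⟨M.estTrans_mem_stdSimplex ξ s a, ?_⟩
  unfold estTrans
  rw [dif_neg hs]
  split_ifs with hn
  · simp [Ne.symm hs]
  · exact (M.exists_projection (empFreq ξ s a) s a hs).choose_spec.1.2

/-- The estimated model, with its absorbing final state. -/
noncomputable def estDiscounted (M : DiscountedMDP S A) {N : ℕ} (ξ : Fin N → SamplePath S A) :
    DiscountedMDP S A :=
  { M.estModel ξ with
    γ := M.γ
    γ_pos := M.γ_pos
    γ_lt_one := M.γ_lt_one
    final := M.final
    final_absorbing := fun a => by simp [estModel, estTrans]
    final_reward := M.final_reward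
    trans_final := fun _ a hs => (M.estTrans_mem_feasibleRows ξ hs a).2 }

lemma sum_sq_estTrans_sub_le (M : DiscountedMDP S A) {N : ℕ} (ξ : Fin N → SamplePath S A)
    {s : S} (hs : s ≠ M.final) (a : A) (hn : ∑ q, transCount ξ s a q ≠ 0) :
    ∑ q, (M.estTrans ξ s a q - M.trans s a q) ^ 2 ≤
      ∑ q, (empFreq ξ s a q - M.trans s a q) ^ 2 := by
  have hp := (M.exists_projection (empFreq ξ s a) s a hs).choose_spec
  rw [estTrans, dif_neg hs, if_neg hn]
  exact sum_sq_sub_le_of_isMinOn M.convex_feasibleRows hp.1 (M.trans_mem_feasibleRows hs a) hp.2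

lemma sum_abs_sub_le_two (M : DiscountedMDP S A) {N : ℕ} (ξ : Fin N → SamplePath S A) (s : S)
    (a : A) : ∑ q, |M.trans s a q - M.estTrans ξ s a q| ≤ 2 := by
  have h := M.estTrans_mem_stdSimplex ξ s a
  calc _ ≤ ∑ q, (M.trans s a q + M.estTrans ξ s a q) := Finset.sum_le_sum fun q _ => by
        rw [abs_le]; constructor <;> linarith [M.trans_nonneg s a q, h.1 q]
    _ = 2 := by rw [Finset.sum_add_distrib, M.trans_sum, h.2]; norm_num

/-- The `ℓ¹` error of an estimated row, on the event that the sample size is at least `n₀` and that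
all coordinates satisfy the Bernstein bounds. -/
lemma sum_abs_sub_le_sqrt (M : DiscountedMDP S A) {N : ℕ} (ξ : Fin N → SamplePath S A)
    {s : S} (hs : s ≠ M.final) (a : A) {n₀ n L : ℝ} (hn₀ : 0 < n₀) (hL : 0 < L)
    (hsum : ∑ q, (transCount ξ s a q : ℝ) = n) (hn : n₀ ≤ n)
    (h1 : ∀ q, tilt n₀ (M.trans s a q) L * (transCount ξ s a q - M.trans s a q * n) -
      M.trans s a q * tilt n₀ (M.trans s a q) L ^ 2 * n ≤ L)
    (h2 : ∀ q, -tilt n₀ (M.trans s a q) L * (transCount ξ s a q - M.trans s a q * n) -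
      M.trans s a q * tilt n₀ (M.trans s a q) L ^ 2 * n ≤ L) :
    ∑ q, |M.trans s a q - M.estTrans ξ s a q| ≤ √(8 * Fintype.card S * (L / n₀)) := by
  have hr : 0 ≤ L / n₀ := by positivity
  by_cases hc : (Fintype.card S : ℝ) * (L / n₀) ≤ 1
  · refine Real.le_sqrt_of_sq_le ?_
    have hne : ∑ q, transCount ξ s a q ≠ 0 := by
      intro h0
      have : ((∑ q, transCount ξ s a q : ℕ) : ℝ) = 0 := by rw [h0]; simp
      push_cast at this
      linarith
    calc (∑ q, |M.trans s a q - M.estTrans ξ s a q|) ^ 2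
        ≤ Fintype.card S * ∑ q, (M.estTrans ξ s a q - M.trans s a q) ^ 2 := by
          refine sq_sum_le_card_mul_sum_sq.trans_eq ?_
          simp only [sq_abs, Finset.card_univ]
          congr 1
          exact Finset.sum_congr rfl fun q _ => by ring
      _ ≤ Fintype.card S * ∑ q, (4 * M.trans s a q * (L / n₀) + 4 * (L / n₀) ^ 2) := by
          refine mul_le_mul_of_nonneg_left ?_ (Nat.cast_nonneg _)
          refine (M.sum_sq_estTrans_sub_le ξ hs a hne).trans (Finset.sum_le_sum fun q _ => ?_)
          rw [empFreq, hsum]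
          exact sq_div_sub_le hn₀ hn (M.trans_nonneg s a q) hL (h1 q) (h2 q)
      _ = Fintype.card S * (4 * (L / n₀) + 4 * (Fintype.card S * (L / n₀)) * (L / n₀)) := by
          rw [Finset.sum_add_distrib, ← Finset.sum_mul, ← Finset.mul_sum, M.trans_sum]
          simp only [Finset.sum_const, Finset.card_univ, nsmul_eq_mul]
          ring
      _ ≤ 8 * Fintype.card S * (L / n₀) := by
          have : (0 : ℝ) ≤ Fintype.card S := by positivity
          nlinarith [mul_nonneg this hr]
  · refine (M.sum_abs_sub_le_two ξ s a).trans (Real.le_sqrt_of_sq_le ?_)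
    linarith

lemma abs_sum_sub_mul_horizonValue_le [Fintype A] (M M' : DiscountedMDP S A) (π : Policy S A)
    (hγ : M'.γ = M.γ) (n : ℕ) (s : S) (a : A) :
    |∑ q, (M.trans s a q - M'.trans s a q) * M'.horizonValue π n q| ≤
      1 / (1 - M.γ) * ∑ q, |M.trans s a q - M'.trans s a q| := by
  rw [Finset.mul_sum]
  refine (Finset.abs_sum_le_sum_abs _ _).trans (Finset.sum_le_sum fun q _ => ?_)
  rw [abs_mul, mul_comm, abs_of_nonneg (M'.horizonValue_nonneg π n q)]
  gcongr
  exact hγ ▸ M'.horizonValue_le π n q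

/-- The crude bound on the one-step error: both rows are probability vectors. -/
lemma abs_sum_sub_mul_horizonValue_le_inv [Fintype A] (M M' : DiscountedMDP S A) (π : Policy S A)
    (hγ : M'.γ = M.γ) (n : ℕ) (s : S) (a : A) :
    |∑ q, (M.trans s a q - M'.trans s a q) * M'.horizonValue π n q| ≤ 1 / (1 - M.γ) := by
  have key : ∀ m : DiscountedMDP S A, 0 ≤ ∑ q, m.trans s a q * M'.horizonValue π n q ∧
      ∑ q, m.trans s a q * M'.horizonValue π n q ≤ 1 / (1 - M.γ) := fun m => by
    refine ⟨Finset.sum_nonneg fun q _ =>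
      mul_nonneg (m.trans_nonneg s a q) (M'.horizonValue_nonneg π n q), ?_⟩
    calc _ ≤ ∑ q, m.trans s a q * (1 / (1 - M.γ)) := Finset.sum_le_sum fun q _ =>
          mul_le_mul_of_nonneg_left (hγ ▸ M'.horizonValue_le π n q) (m.trans_nonneg s a q)
      _ = _ := by rw [← Finset.sum_mul, m.trans_sum, one_mul]
  have h1 := key M
  have h2 := key M'
  simp only [sub_mul, Finset.sum_sub_distrib]
  rw [abs_le]
  constructor <;> linarith

end DiscountedMDP

/-! ### Sample size and confidence -/

/-- The contribution of a relevant pair, with target occupancy `x`, behavior occupancy `xb` and an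
`ℓ¹` error of order `√(S L / (N xb))`. Weighted AM-GM replaces Hölder's inequality. -/
lemma mul_sqrt_le_of_coverage {S A g ε β x xb N L : ℝ} (hS : 0 < S) (hA : 0 < A) (hg : 0 < g)
    (hε : 0 < ε) (hβ0 : 0 ≤ β) (hβ1 : β ≤ 1) (hx : 0 ≤ x) (hxb : 0 < xb) (hN : 0 < N) (hL : 0 < L)
    (h : 64 * L * (S ^ (1 + 2 * β) * A ^ (2 * β) / (g ^ (4 - 2 * β) * ε ^ 2) *
      (x ^ (2 * β) / xb)) ≤ N) :
    x * (1 / g * √(8 * S * (L / (N * xb / 2)))) ≤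
      ε / 2 * (g * ((1 - β) * x + β * (1 / (g * S * A)))) := by
  set c := 1 / (g * S * A) with hc
  have hc0 : 0 < c := by positivity
  rcases hx.eq_or_lt with hx0 | hx0
  · rw [← hx0]
    simp only [zero_mul, mul_zero, zero_add]
    positivity
  set Q := (g * S * A * x) ^ (2 * β) with hQ
  have hQ0 : 0 < Q := by positivity
  have hcx : (c / x) ^ β * (c / x) ^ β = 1 / Q := by
    rw [← Real.rpow_add (by positivity), hQ, ← two_mul, one_div,
      ← Real.inv_rpow (by positivity), hc]
    congr 1
    field_simp
  have h1 : 64 * L * S * Q ≤ N * xb * g ^ 4 * ε ^ 2 := by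
    have e : 64 * L * (S ^ (1 + 2 * β) * A ^ (2 * β) / (g ^ (4 - 2 * β) * ε ^ 2) *
        (x ^ (2 * β) / xb)) = 64 * L * S * Q / (xb * g ^ 4 * ε ^ 2) := by
      rw [hQ, Real.rpow_add hS, Real.rpow_one, Real.rpow_sub hg,
        Real.mul_rpow (by positivity) hx, Real.mul_rpow (by positivity) hA.le,
        Real.mul_rpow hg.le hS.le]
      have : g ^ (4 : ℝ) = g ^ 4 := by exact_mod_cast Real.rpow_natCast g 4
      rw [this]
      have := Real.rpow_pos_of_pos hg (2 * β)
      field_simp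
    rw [e, div_le_iff₀ (by positivity)] at h
    linarith
  have h2 : √(8 * S * (L / (N * xb / 2))) ≤ ε / 2 * g ^ 2 * (c / x) ^ β := by
    refine Real.sqrt_le_iff.2 ⟨by positivity, ?_⟩
    have e : (ε / 2 * g ^ 2 * (c / x) ^ β) ^ 2 = ε ^ 2 * g ^ 4 / 4 / Q := by
      rw [mul_pow, sq ((c / x) ^ β), hcx]; ring
    rw [e, le_div_iff₀ hQ0]
    have e2 : 8 * S * (L / (N * xb / 2)) * Q = 16 * L * S * Q / (N * xb) := by field_simp; ring
    rw [e2, div_le_iff₀ (by positivity)]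
    linarith
  have h3 : x * (c / x) ^ β = x ^ (1 - β) * c ^ β := by
    rw [Real.div_rpow hc0.le hx, Real.rpow_sub hx0, Real.rpow_one]
    field_simp
  calc x * (1 / g * √(8 * S * (L / (N * xb / 2))))
      ≤ x * (1 / g * (ε / 2 * g ^ 2 * (c / x) ^ β)) := by gcongr
    _ = ε / 2 * (g * (x * (c / x) ^ β)) := by field_simp
    _ ≤ _ := by
        rw [h3]
        have := Real.geom_mean_le_arith_mean2_weighted (w₁ := 1 - β) (w₂ := β) (by linarith) hβ0 hx
          hc0.le (by ring)
        gcongr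

/-- The threshold is chosen such that each negligible pair costs at most `ε / (2 S A)`. -/
lemma threshold_mul_inv_le {g ε β : ℝ} (hg : 0 < g) (hε : 0 < ε) (hβ0 : 0 < β) (hβ1 : β ≤ 1)
    (h : ε / 2 * g ^ 2 ≤ 1) :
    (ε / 2) ^ (1 / β) * g ^ ((2 - β) / β) * (1 / g) ≤ ε / 2 := by
  have e1 : (1 / β) = 1 + (1 - β) / β := by field_simp; ring
  have e2 : ((2 - β) / β) = 1 + 2 * ((1 - β) / β) := by field_simp; ring
  have e3 : g ^ (2 * ((1 - β) / β)) = (g ^ 2) ^ ((1 - β) / β) := by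
    rw [Real.rpow_mul hg.le]
    norm_num
  have hε2 : 0 < ε / 2 := by positivity
  rw [e1, e2, Real.rpow_add hε2, Real.rpow_add hg, Real.rpow_one, Real.rpow_one, e3]
  have e4 : ε / 2 * (ε / 2) ^ ((1 - β) / β) * (g * (g ^ 2) ^ ((1 - β) / β)) * (1 / g) =
      ε / 2 * (ε / 2 * g ^ 2) ^ ((1 - β) / β) := by
    rw [Real.mul_rpow hε2.le (by positivity)]
    field_simp
  rw [e4]
  refine mul_le_of_le_one_right hε2.le (Real.rpow_le_one (by positivity) h ?_)
  exact div_nonneg (by linarith) hβ0.le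

/-- The confidence level of the union bound is dominated by the logarithmic factor. -/
lemma log_union_le {S A g ε δ : ℝ} (hS : 1 ≤ S) (hA : 1 ≤ A) (hg : 0 < g) (hg1 : g ≤ 1)
    (hε : 0 < ε) (hδ : 0 < δ) (hδ1 : δ < 1) :
    Real.log (3 * S ^ 2 * A / δ) ≤ 9 * (Real.log (S + A + 1 / g + 1 / ε) * Real.log (2 / δ)) := by
  set X := S + A + 1 / g + 1 / ε with hX
  have hg' : 1 ≤ 1 / g := by rw [le_div_iff₀ hg]; linarith
  have hε' : 0 < 1 / ε := by positivity
  have hX3 : 3 ≤ X := by linarith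
  have ha : 1 ≤ Real.log X := by
    rw [Real.le_log_iff_exp_le (by linarith)]
    linarith [Real.exp_one_lt_d9]
  have hb : 1 / 2 ≤ Real.log (2 / δ) := by
    have h1 : Real.log 2 ≤ Real.log (2 / δ) :=
      Real.log_le_log (by norm_num) (by rw [le_div_iff₀ hδ]; linarith)
    linarith [Real.log_two_gt_d9]
  have h1 : 3 * S ^ 2 * A / δ ≤ X ^ 4 * (2 / δ) := by
    rw [mul_div_assoc', div_le_div_iff_of_pos_right hδ]
    have hSX : S ≤ X := by linarith
    have hAX : A ≤ X := by linarith
    have h2 : 3 * S ^ 2 * A ≤ X * X ^ 2 * X := by gcongr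
    nlinarith [pow_pos (show 0 < X by linarith) 4]
  have h2 : Real.log (3 * S ^ 2 * A / δ) ≤ 4 * Real.log X + Real.log (2 / δ) := by
    refine (Real.log_le_log (by positivity) h1).trans_eq ?_
    rw [Real.log_mul (by positivity) (by positivity), Real.log_pow]
    norm_num
  nlinarith

namespace DiscountedMDP

variable {S A : Type*} [Fintype S] [Fintype A] [MeasurableSpace S] [MeasurableSpace A]
  [MeasurableSingletonClass S] [MeasurableSingletonClass A]

lemma reachProb_le_occupancy (M : DiscountedMDP S A) (π : Policy S A) (s : S) (a : A) :
    M.reachProb π s a ≤ M.occupancy π s a := by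
  refine le_trans ?_ (M.reachProb_mul_tsum_returnProb_le π s a)
  refine le_mul_of_one_le_right zero_le (le_trans ?_ (ENNReal.le_tsum 0))
  simp [MDP.returnProb]

/-- With high probability a row of the estimated model is accurate in `ℓ¹`, at the precision that
corresponds to half of the expected number of samples. -/
lemma measure_row_error_le (M : DiscountedMDP S A) (π : Policy S A) {Ω : Type*} [MeasurableSpace Ω]
    {μ : Measure Ω} {N : ℕ} {ξ : Fin N → Ω → SamplePath S A} (hind : iIndepFun ξ μ)
    (hlaw : ∀ i, HasLaw (ξ i) (M.pathLaw π) μ) (hN : 0 < N) {s : S} (hs : s ≠ M.final) (a : A)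
    (hρ : M.reachProb π s a ≠ 0) {L : ℝ} (hL : 0 < L)
    (hNL : L ≤ N * (M.reachProb π s a).toReal / 32) :
    μ {ω | ¬ ∑ q, |M.trans s a q - M.estTrans (fun i => ξ i ω) s a q| ≤
        √(8 * Fintype.card S * (L / (N * (M.occupancy π s a).toReal / 2)))} ≤
      (1 + 2 * Fintype.card S) * ENNReal.ofReal (Real.exp (-L)) := by
  set x := (M.occupancy π s a).toReal with hx
  set ρ := (M.reachProb π s a).toReal with hρr
  have hxt := M.occupancy_ne_top π hs a
  have hρ0 : 0 < ρ := ENNReal.toReal_pos hρ (measure_ne_top _ _)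
  have hx0 : 0 < x := hρ0.trans_le (ENNReal.toReal_mono hxt (M.reachProb_le_occupancy π s a))
  have hN' : (0 : ℝ) < N := by exact_mod_cast hN
  set n₀ := N * x / 2 with hn₀
  have hn₀pos : 0 < n₀ := by positivity
  set n : Ω → ℝ := fun ω => ∑ i, (visitCount s a (ξ i ω)).toReal with hn
  set m : S → Ω → ℝ := fun q ω => ∑ i, (moveCount s a q (ξ i ω)).toReal with hm
  set E₁ : Set Ω := {ω | n ω ≤ n₀} with hE₁
  set E₂ : ℝ → S → Set Ω := fun l q =>
    {ω | L ≤ l * (m q ω - M.trans s a q * n ω) - M.trans s a q * l ^ 2 * n ω} with hE₂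
  -- few samples: the exponential moment at `-ρ / (8 x)`
  have b1 : μ E₁ ≤ ENNReal.ofReal (Real.exp (-L)) := by
    have h := measure_le_sum_le_exp hind hlaw
      (g := fun ξ => -(ρ / (8 * x)) * (visitCount s a ξ).toReal)
      ((measurable_visitCount s a).ennreal_toReal.const_mul _)
      (M.lintegral_exp_neg_visitCount_le π hs a hρ (l := ρ / (8 * x)) (by positivity))
      (-(ρ / (8 * x)) * n₀)
    refine (measure_mono fun ω hω => ?_).trans (h.trans ?_)
    · simp only [hE₁, Set.mem_ofPred_eq] at hω ⊢
      rw [← Finset.mul_sum]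
      exact mul_le_mul_of_nonpos_left hω (by rw [neg_nonpos]; positivity)
    · refine ENNReal.ofReal_le_ofReal (Real.exp_le_exp.2 ?_)
      have e : N * (-(ρ / (8 * x)) * x + (ρ / (8 * x)) ^ 2 * (2 * x ^ 2 / ρ)) -
          -(ρ / (8 * x)) * n₀ = -(N * ρ / 32) := by
        rw [hn₀]; field_simp; ring
      rw [e]; linarith
  have b2 : ∀ l : ℝ, |l| ≤ 1 → ∀ q, μ (E₂ l q) ≤ ENNReal.ofReal (Real.exp (-L)) := fun l hl q => by
    have h := measure_le_sum_le_exp hind hlaw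
      (g := fun ξ => l * (moveCount s a q ξ).toReal -
        M.trans s a q * (l + l ^ 2) * (visitCount s a ξ).toReal)
      (((measurable_moveCount s a q).ennreal_toReal.const_mul _).sub
        ((measurable_visitCount s a).ennreal_toReal.const_mul _)) (c := 0)
      (by simpa using M.lintegral_exp_moveCount_le π hs a q hl) L
    rw [mul_zero, zero_sub] at h
    refine (measure_mono fun ω hω => ?_).trans h
    simp only [hE₂, Set.mem_ofPred_eq] at hω ⊢
    rw [Finset.sum_sub_distrib, ← Finset.mul_sum, ← Finset.mul_sum]
    linarith
  set τ : S → ℝ := fun q => tilt n₀ (M.trans s a q) L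
  have hτ : ∀ q, |τ q| ≤ 1 := fun q => by
    rw [abs_of_pos (tilt_pos hL)]; exact tilt_le_one hL
  have hfin : ∀ᵐ ω ∂μ, ∀ i, visitCount s a (ξ i ω) < ∞ := ae_all_iff.2 fun i => by
    have h := M.ae_visitCount_lt_top π hs a
    rw [← (hlaw i).map_eq] at h
    exact ae_of_ae_map (hlaw i).aemeasurable h
  have hsub : {ω | ¬ ∑ q, |M.trans s a q - M.estTrans (fun i => ξ i ω) s a q| ≤
      √(8 * Fintype.card S * (L / n₀))} ≤ᵐ[μ]
      (E₁ ∪ ⋃ q, (E₂ (τ q) q ∪ E₂ (-τ q) q) : Set Ω) := by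
    filter_upwards [hfin] with ω hω hbad
    by_contra hgood
    apply hbad
    have hg : ω ∉ E₁ ∪ ⋃ q, (E₂ (τ q) q ∪ E₂ (-τ q) q) := hgood
    simp only [Set.mem_union, Set.mem_iUnion, not_or, not_exists, hE₁, hE₂, Set.mem_ofPred_eq,
      not_le] at hg
    have hcount : ∀ q, (transCount (fun i => ξ i ω) s a q : ℝ) = m q ω := fun q =>
      transCount_eq_sum (fun i => ξ i ω) s a q hω
    refine M.sum_abs_sub_le_sqrt (fun i => ξ i ω) hs a (n := n ω) hn₀pos hL ?_ hg.1.le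
      (fun q => ?_) (fun q => ?_)
    · simp only [hcount, hm, hn]
      rw [Finset.sum_comm]
      refine Finset.sum_congr rfl fun i _ => ?_
      rw [← sum_moveCount, ENNReal.toReal_sum fun q _ =>
        ((moveCount_le_visitCount s a q (ξ i ω)).trans_lt (hω i)).ne]
    · rw [hcount]; exact (hg.2 q).1.le
    · have := (hg.2 q).2.le
      rw [neg_sq] at this
      rw [hcount]; exact this
  refine (measure_mono_ae hsub).trans ((measure_union_le _ _).trans ?_)
  rw [add_mul, one_mul]
  refine add_le_add b1 ((measure_iUnion_fintype_le μ _).trans ?_)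
  calc _ ≤ ∑ _q : S, 2 * ENNReal.ofReal (Real.exp (-L)) := Finset.sum_le_sum fun q _ => by
        rw [two_mul]
        exact (measure_union_le _ _).trans (add_le_add (b2 _ (hτ q) q)
          (b2 _ (by rw [abs_neg]; exact hτ q) q))
    _ = _ := by rw [Finset.sum_const, nsmul_eq_mul, Finset.card_univ]; ring

lemma one_le_reachTerm (M : DiscountedMDP S A) (π : Policy S A) (s : S) (a : A) :
    1 ≤ M.reachTerm π s a := by
  have h1 : ENNReal.ofReal M.γ * M.reachProb π s a ≤ 1 :=
    mul_le_one' (ENNReal.ofReal_le_one.2 M.γ_lt_one.le) prob_le_one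
  rw [reachTerm, one_div]
  exact ENNReal.one_le_inv.2 h1

/-- Some `β` attains the infimum up to a factor `2`. -/
lemma exists_forall_relevantPairs_mul_le (M : DiscountedMDP S A) (πb πt : Policy S A) (ε : ℝ)
    {K : ℝ} (hK : 0 < K) {N : ℕ} (h : ENNReal.ofReal K * M.requiredPaths πb πt ε ≤ N) :
    ∃ β ∈ Set.Icc (0 : ℝ) 1, ∀ p ∈ M.relevantPairs πt ε β, ENNReal.ofReal (K / 2) *
      max (M.coverageTerm πb πt ε β p.1 p.2) (M.reachTerm πb p.1 p.2) ≤ N := by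
  by_contra hcon
  push Not at hcon
  set I := M.requiredPaths πb πt ε with hI
  have hK0 : ENNReal.ofReal K ≠ 0 := by simpa using hK
  have hIt : I ≠ ∞ := by
    intro hI'
    rw [hI', ENNReal.mul_top hK0] at h
    exact ENNReal.natCast_ne_top N (top_le_iff.1 h)
  have hK2 : ENNReal.ofReal (K / 2) ≠ 0 := by simpa using hK
  have hlow : ∀ β ∈ Set.Icc (0 : ℝ) 1, max 1 ((N : ℝ≥0∞) / ENNReal.ofReal (K / 2)) ≤
      ⨆ p ∈ M.relevantPairs πt ε β,
        max (M.coverageTerm πb πt ε β p.1 p.2) (M.reachTerm πb p.1 p.2) := fun β hβ => by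
    obtain ⟨p, hp, hlt⟩ := hcon β hβ
    refine le_trans (max_le ?_ ?_) (le_biSup (fun p : S × A =>
      max (M.coverageTerm πb πt ε β p.1 p.2) (M.reachTerm πb p.1 p.2)) hp)
    · exact (M.one_le_reachTerm πb p.1 p.2).trans (le_max_right _ _)
    · rw [ENNReal.div_le_iff_le_mul (Or.inl hK2) (Or.inl ENNReal.ofReal_ne_top), mul_comm]
      exact hlt.le
  have hle : max 1 ((N : ℝ≥0∞) / ENNReal.ofReal (K / 2)) ≤ I := le_iInf₂ hlow
  have h1 : 1 ≤ I := (le_max_left _ _).trans hle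
  have h2 : (N : ℝ≥0∞) ≤ ENNReal.ofReal (K / 2) * I := by
    have := (le_max_right _ _).trans hle
    rwa [ENNReal.div_le_iff_le_mul (Or.inl hK2) (Or.inl ENNReal.ofReal_ne_top), mul_comm] at this
  have h3 := (ENNReal.mul_le_mul_iff_left (zero_lt_one.trans_le h1).ne' hIt).1 (h.trans h2)
  rw [ENNReal.ofReal_le_ofReal_iff (by positivity)] at h3
  linarith

/-- The sample-size condition at a relevant pair, in real numbers. -/
lemma real_bounds_of_mul_max_le (M : DiscountedMDP S A) (πb πt : Policy S A) {ε β k : ℝ}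
    (hε : 0 < ε) (hk : 0 < k) {N : ℕ} (s : S) (a : A)
    (h : ENNReal.ofReal k * max (M.coverageTerm πb πt ε β s a) (M.reachTerm πb s a) ≤ N) :
    M.reachProb πb s a ≠ 0 ∧ k ≤ N * (M.reachProb πb s a).toReal ∧
      k * ((Fintype.card S : ℝ) ^ (1 + 2 * β) * (Fintype.card A : ℝ) ^ (2 * β) /
        ((1 - M.γ) ^ (4 - 2 * β) * ε ^ 2) * ((M.occupancy πt s a).toReal ^ (2 * β) /
          (M.occupancy πb s a).toReal)) ≤ N := by
  have hk0 : ENNReal.ofReal k ≠ 0 := by simpa using hk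
  have hNt : (N : ℝ≥0∞) ≠ ∞ := ENNReal.natCast_ne_top N
  have h1 := (mul_le_mul_right (le_max_left _ _) (ENNReal.ofReal k)).trans h
  have h2 := (mul_le_mul_right (le_max_right _ _) (ENNReal.ofReal k)).trans h
  have hρ : M.reachProb πb s a ≠ 0 := by
    intro h0
    rw [reachTerm, h0, mul_zero, ENNReal.div_zero one_ne_zero, ENNReal.mul_top hk0] at h2
    exact hNt (top_le_iff.1 h2)
  have hγ : 0 < 1 - M.γ := by linarith [M.γ_lt_one]
  refine ⟨hρ, ?_, ?_⟩
  · have hρ0 : 0 < (M.reachProb πb s a).toReal := ENNReal.toReal_pos hρ (measure_ne_top _ _)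
    have h3 := ENNReal.toReal_mono hNt h2
    rw [reachTerm, ENNReal.toReal_mul, ENNReal.toReal_div, ENNReal.toReal_mul,
      ENNReal.toReal_ofReal hk.le, ENNReal.toReal_ofReal M.γ_pos.le, ENNReal.toReal_one,
      ENNReal.toReal_natCast, mul_one_div, div_le_iff₀ (mul_pos M.γ_pos hρ0)] at h3
    refine h3.trans ?_
    gcongr
    exact mul_le_of_le_one_left hρ0.le M.γ_lt_one.le
  · have h3 := ENNReal.toReal_mono hNt h1
    rwa [coverageTerm, ENNReal.toReal_mul, ENNReal.toReal_mul, ENNReal.toReal_div,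
      ENNReal.toReal_ofReal hk.le, ENNReal.toReal_ofReal (by positivity), ENNReal.toReal_natCast,
      ← ENNReal.toReal_rpow] at h3

end DiscountedMDP

/-! ### Accuracy of the estimated value -/

namespace DiscountedMDP

variable {S A : Type*} [Fintype S] [Fintype A] [MeasurableSpace S] [MeasurableSpace A]
  [MeasurableSingletonClass S] [MeasurableSingletonClass A]

/-- If the rows of all relevant pairs are accurate, then the estimated value is `ε`-accurate. The
relevant pairs and the negligible pairs contribute at most `ε / 2` each. -/
lemma abs_value_sub_estimate_le (M : DiscountedMDP S A) (πb πt : Policy S A) {ε β L : ℝ}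
    (hε : 0 < ε) (hεγ : ε / 2 * (1 - M.γ) ^ 2 ≤ 1) (hβ : β ∈ Set.Icc (0 : ℝ) 1) (hL : 0 < L)
    {N : ℕ} (hcov : ∀ p ∈ M.relevantPairs πt ε β, ENNReal.ofReal (64 * L) *
      max (M.coverageTerm πb πt ε β p.1 p.2) (M.reachTerm πb p.1 p.2) ≤ N)
    (ξ : Fin N → SamplePath S A)
    (hrow : ∀ p ∈ M.relevantPairs πt ε β, ∑ q, |M.trans p.1 p.2 q - M.estTrans ξ p.1 p.2 q| ≤
      √(8 * Fintype.card S * (L / (N * (M.occupancy πb p.1 p.2).toReal / 2)))) :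
    |M.value πt - (M.estModel ξ).value πt| ≤ ε := by
  classical
  set M' := M.estDiscounted ξ with hM'
  change |M.value πt - M'.value πt| ≤ ε
  set g := 1 - M.γ with hg
  have hg0 : 0 < g := by linarith [M.γ_lt_one]
  set cS := (Fintype.card S : ℝ) with hcS
  set cA := (Fintype.card A : ℝ) with hcA
  have hS0 : 0 < cS := by
    rw [hcS]; exact_mod_cast Fintype.card_pos_iff.2 ⟨M.init⟩
  have hA0 : 0 < cA := by
    rw [hcA]
    refine Nat.cast_pos.2 (Fintype.card_pos_iff.2 ?_)
    by_contra h
    rw [not_nonempty_iff] at h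
    simpa using πt.prob_sum M.init
  have hβ1 : 0 ≤ 1 - β := by linarith [hβ.2]
  have hβ0 : 0 ≤ β := hβ.1
  set Δ : S → A → ℝ := fun s a => if (s, a) ∈ M.relevantPairs πt ε β then
    1 / g * ∑ q, |M.trans s a q - M'.trans s a q| else 1 / g with hΔ
  have hsim := M.abs_value_sub_le M' πt Δ rfl rfl rfl fun n s a _ => by
    simp only [hΔ]
    split_ifs
    · exact M.abs_sum_sub_mul_horizonValue_le M' πt rfl n s a
    · exact M.abs_sum_sub_mul_horizonValue_le_inv M' πt rfl n s a
  set u := ε / 2 * g * (1 - β) with hu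
  set v := ε / 2 * (g * (β * (1 / (g * cS * cA)))) + ε / 2 / (cS * cA) with hv
  have hu0 : 0 ≤ u := by positivity
  have hv0 : 0 ≤ v := by positivity
  have hpair : ∀ s ∈ Finset.univ.erase M.final, ∀ a,
      (M.occupancy πt s a).toReal * Δ s a ≤ u * (M.occupancy πt s a).toReal + v := fun s hs a => by
    have hs' : s ≠ M.final := (Finset.mem_erase.1 hs).1
    have hx := M.occupancy_ne_top πt hs' a
    have hx0 : 0 ≤ (M.occupancy πt s a).toReal := ENNReal.toReal_nonneg
    by_cases hD : (s, a) ∈ M.relevantPairs πt ε β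
    · obtain ⟨hρ, hρN, hcN⟩ :=
        M.real_bounds_of_mul_max_le πb πt hε (by positivity) s a (hcov (s, a) hD)
      have hρ0 : 0 < (M.reachProb πb s a).toReal := ENNReal.toReal_pos hρ (measure_ne_top _ _)
      have hxb : 0 < (M.occupancy πb s a).toReal := hρ0.trans_le
        (ENNReal.toReal_mono (M.occupancy_ne_top πb hs' a) (M.reachProb_le_occupancy πb s a))
      have hN : (0 : ℝ) < N := pos_of_mul_pos_left (by linarith) hρ0.le
      have h1 := mul_sqrt_le_of_coverage hS0 hA0 hg0 hε hβ0 hβ.2 hx0 hxb hN hL hcN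
      have h2 := hrow (s, a) hD
      simp only [hΔ, hD, ↓reduceIte]
      calc _ ≤ _ := mul_le_mul_of_nonneg_left
            (mul_le_mul_of_nonneg_left h2 (by positivity : 0 ≤ 1 / g)) hx0
        _ ≤ _ := h1
        _ ≤ _ := by
          have : 0 ≤ ε / 2 / (cS * cA) := by positivity
          rw [hu, hv]; linarith
    · have hlt : M.occupancy πt s a < ENNReal.ofReal (M.threshold ε β) := by
        by_contra hc
        exact hD ⟨hs', not_lt.1 hc⟩
      have hβpos : 0 < β := by
        refine hβ0.lt_of_ne fun h0 => ?_
        simp [threshold, ← h0] at hlt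
      have hx1 : (M.occupancy πt s a).toReal ≤ M.threshold ε β :=
        ((ENNReal.lt_ofReal_iff_toReal_lt hx).1 hlt).le
      rw [threshold, if_neg hβpos.ne'] at hx1
      simp only [hΔ, hD, ↓reduceIte]
      calc _ ≤ (ε / 2) ^ (1 / β) * g ^ ((2 - β) / β) / (cS * cA) * (1 / g) :=
            mul_le_mul_of_nonneg_right hx1 (by positivity)
        _ = (ε / 2) ^ (1 / β) * g ^ ((2 - β) / β) * (1 / g) / (cS * cA) := by ring
        _ ≤ ε / 2 / (cS * cA) := by
            gcongr
            exact threshold_mul_inv_le hg0 hε hβpos hβ.2 hεγ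
        _ ≤ _ := by
            have h1 : 0 ≤ ε / 2 * (g * (β * (1 / (g * cS * cA)))) := by positivity
            have h2 := mul_nonneg hu0 hx0
            rw [hv]; linarith
  have hcard : ((Finset.univ.erase M.final).card : ℝ) ≤ cS := by
    rw [hcS]
    exact_mod_cast Finset.card_le_univ _
  calc _ ≤ _ := hsim
    _ ≤ ∑ s ∈ Finset.univ.erase M.final, ∑ a, (u * (M.occupancy πt s a).toReal + v) :=
        Finset.sum_le_sum fun s hs => Finset.sum_le_sum fun a _ => hpair s hs a
    _ = u * ∑ s ∈ Finset.univ.erase M.final, ∑ a, (M.occupancy πt s a).toReal +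
          (Finset.univ.erase M.final).card * (cA * v) := by
        simp only [Finset.sum_add_distrib, ← Finset.mul_sum, Finset.sum_const, nsmul_eq_mul,
          Finset.card_univ, hcA]
        ring
    _ ≤ u * (1 / g) + cS * (cA * v) := by
        gcongr
        exact M.sum_toReal_occupancy_le πt
    _ = ε := by rw [hu, hv]; field_simp; ring

end DiscountedMDP

theorem theorem1 :
    ∃ C : ℝ, 0 < C ∧ ∃ k : ℕ,
      ∀ (S A : Type*) [Fintype S] [Fintype A] [MeasurableSpace S] [MeasurableSpace A]
        [MeasurableSingletonClass S] [MeasurableSingletonClass A]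
        (M : DiscountedMDP S A) (πb πt : Policy S A) (ε δ : ℝ),
        0 < ε → 0 < δ → δ < 1 →
        ∀ (Ω : Type*) [MeasurableSpace Ω] (μ : Measure Ω) [IsProbabilityMeasure μ]
          (N : ℕ) (ξ : Fin N → Ω → SamplePath S A),
          iIndepFun ξ μ →
          (∀ i, HasLaw (ξ i) (M.pathLaw πb) μ) →
          ENNReal.ofReal (M.logFactor C k ε δ) * M.requiredPaths πb πt ε ≤ (N : ℝ≥0∞) →
          1 - δ ≤ μ.real {ω | |M.value πt - (M.estModel (fun i => ξ i ω)).value πt| ≤ ε} := by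
  refine ⟨1152, by norm_num, 1, ?_⟩
  intro S A _ _ _ _ _ _ M πb πt ε δ hε hδ hδ1 Ω _ μ _ N ξ hind hlaw hN
  have hg0 : 0 < 1 - M.γ := by linarith [M.γ_lt_one]
  have hg1 : 1 - M.γ ≤ 1 := by linarith [M.γ_pos]
  rcases le_or_gt (1 / (1 - M.γ)) ε with htriv | hsmall
  · -- both values lie in `[0, 1 / (1 - γ)]`
    have : {ω | |M.value πt - (M.estModel (fun i => ξ i ω)).value πt| ≤ ε} = Set.univ := by
      refine Set.eq_univ_of_forall fun ω => ?_
      have h1 := M.value_nonneg πt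
      have h2 := M.value_le πt
      have h3 : 0 ≤ (M.estModel fun i => ξ i ω).value πt := (M.estDiscounted _).value_nonneg πt
      have h4 : (M.estModel fun i => ξ i ω).value πt ≤ 1 / (1 - M.γ) :=
        (M.estDiscounted _).value_le πt
      rw [Set.mem_ofPred_eq, abs_le]
      constructor <;> linarith
    rw [this, probReal_univ]
    linarith
  have hεγ : ε / 2 * (1 - M.γ) ^ 2 ≤ 1 := by
    rw [lt_div_iff₀ hg0] at hsmall
    nlinarith
  have hS1 : (1 : ℝ) ≤ Fintype.card S := by
    exact_mod_cast Fintype.card_pos_iff.2 ⟨M.init⟩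
  have hA1 : (1 : ℝ) ≤ Fintype.card A := by
    have : 0 < Fintype.card A := by
      refine Fintype.card_pos_iff.2 ?_
      by_contra h
      rw [not_nonempty_iff] at h
      simpa using πt.prob_sum M.init
    exact_mod_cast this
  -- the union bound runs over `S A` rows, each with failure probability `(1 + 2 S) exp (-L)`
  set L := Real.log (3 * (Fintype.card S : ℝ) ^ 2 * Fintype.card A / δ) with hLdef
  have harg : 1 < 3 * (Fintype.card S : ℝ) ^ 2 * Fintype.card A / δ := by
    rw [lt_div_iff₀ hδ]
    have : 1 ≤ (Fintype.card S : ℝ) ^ 2 * Fintype.card A :=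
      one_le_mul_of_one_le_of_one_le (one_le_pow₀ hS1) hA1
    nlinarith
  have hL : 0 < L := Real.log_pos harg
  have hK : 2 * (64 * L) ≤ M.logFactor 1152 1 ε δ := by
    have := log_union_le hS1 hA1 hg0 hg1 hε hδ hδ1
    rw [DiscountedMDP.logFactor, pow_one]
    linarith
  obtain ⟨β, hβ, hcov⟩ := M.exists_forall_relevantPairs_mul_le πb πt ε (K := 2 * (64 * L))
    (by positivity) ((mul_le_mul_left (ENNReal.ofReal_le_ofReal hK) _).trans hN)
  rw [mul_div_cancel_left₀ _ (two_ne_zero' ℝ)] at hcov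
  set bad : S × A → Set Ω := fun p => {ω | p ∈ M.relevantPairs πt ε β ∧
    ¬ ∑ q, |M.trans p.1 p.2 q - M.estTrans (fun i => ξ i ω) p.1 p.2 q| ≤
      √(8 * Fintype.card S * (L / (N * (M.occupancy πb p.1 p.2).toReal / 2)))} with hbad
  have hbadp : ∀ p, μ (bad p) ≤ (1 + 2 * Fintype.card S) * ENNReal.ofReal (Real.exp (-L)) :=
    fun p => by
      by_cases hp : p ∈ M.relevantPairs πt ε β
      · obtain ⟨hρ, hρN, -⟩ :=
          M.real_bounds_of_mul_max_le πb πt hε (by positivity) p.1 p.2 (hcov p hp)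
        have hNpos : 0 < N := by
          rcases Nat.eq_zero_or_pos N with h0 | h0
          · rw [h0, Nat.cast_zero, zero_mul] at hρN
            linarith
          · exact h0
        exact (measure_mono fun ω hω => hω.2).trans
          (M.measure_row_error_le πb hind hlaw hNpos hp.1 p.2 hρ hL (by linarith))
      · have : bad p = ∅ := Set.eq_empty_of_forall_notMem fun ω hω => hp hω.1
        rw [this, measure_empty]
        exact zero_le
  have hbadU : μ.real (⋃ p, bad p) ≤ δ := by
    refine ENNReal.toReal_le_of_le_ofReal hδ.le ?_
    have h1 : μ (⋃ p, bad p) ≤ ∑ _p : S × A,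
        (1 + 2 * Fintype.card S) * ENNReal.ofReal (Real.exp (-L)) :=
      (measure_iUnion_fintype_le μ bad).trans (Finset.sum_le_sum fun p _ => hbadp p)
    refine h1.trans ?_
    have e : (1 + 2 * (Fintype.card S : ℝ≥0∞)) = ENNReal.ofReal (1 + 2 * Fintype.card S) := by
      rw [ENNReal.ofReal_add zero_le_one (by positivity), ENNReal.ofReal_mul (by norm_num)]
      simp
    rw [Finset.sum_const, Finset.card_univ, Fintype.card_prod, nsmul_eq_mul, e,
      ← ENNReal.ofReal_mul (by positivity), ← ENNReal.ofReal_natCast,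
      ← ENNReal.ofReal_mul (by positivity)]
    refine ENNReal.ofReal_le_ofReal ?_
    rw [Real.exp_neg, Real.exp_log (by linarith), inv_div, Nat.cast_mul]
    have hpos : 0 < 3 * (Fintype.card S : ℝ) ^ 2 * Fintype.card A := by positivity
    rw [mul_div_assoc', mul_div_assoc', div_le_iff₀ hpos]
    have : (Fintype.card S : ℝ) * Fintype.card A * (1 + 2 * Fintype.card S) ≤
        3 * (Fintype.card S : ℝ) ^ 2 * Fintype.card A := by nlinarith
    nlinarith
  have hcover : (Set.univ : Set Ω) ⊆
      {ω | |M.value πt - (M.estModel (fun i => ξ i ω)).value πt| ≤ ε} ∪ ⋃ p, bad p := fun ω _ => by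
    by_cases h : ω ∈ ⋃ p, bad p
    · exact Or.inr h
    · refine Or.inl (M.abs_value_sub_estimate_le πb πt hε hεγ hβ hL hcov _ fun p hp => ?_)
      by_contra hc
      exact h (Set.mem_iUnion.2 ⟨p, hp, hc⟩)
  have h1 := (measureReal_mono hcover).trans (measureReal_union_le (μ := μ) _ _)
  rw [probReal_univ] at h1
  linarith
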